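/- Let $C$ be the nonsingular model of the projective closure of the plane curve $u^4=t^2(t-1)$; it has one point $P_1$ over $t=1$, one point $P_\infty$ over $t=\infty$ and two points over $t=0$ (the two branches at the node $(0,0)$). Put $\varphi=\dfrac{u\,dt}{t(t-1)}$, a holomorphic $1$-form on $C$, $B(\tfrac14,\tfrac14)=\int_0^1 x^{-3/4}(1-x)^{-3/4}dx$, $L=\mathbb{Z}i+\mathbb{Z}$, $E=\mathbb{C}/L$, and $$\vartheta_{a,b}(z,\tau)=\sum_{n\in\mathbb{Z}}\exp\bigl(\pi i(n+a)^2\tau+2\pi i(n+a)(z+b)\bigr).$$ Then the Abel–Jacobi map $$\jmath:C\to E,\qquad P\mapsto \frac{1}{(1-i)B(\frac14,\frac14)}\int_{P_1}^{P}\varphi \bmod L$$ is well defined (independent of the path) and is a homeomorphism. Its inverse $z\mapsto (t,u)$ is given, for every $z\in\mathbb{C}$ with $\vartheta_{0,0}(z,i)\neq0$, by $$t=2\,\frac{\vartheta_{0,\frac12}(z,i)^2\,\vartheta_{\frac12,0}(z,i)^2}{\vartheta_{0,0}(z,i)^4}=1-\frac{\vartheta_{\frac12,\frac12}(z,i)^4}{\vartheta_{0,0}(z,i)^4},\qquad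 u=-(1-i)\,\frac{\vartheta_{0,\frac12}(z,i)\,\vartheta_{\frac12,0}(z,i)\,\vartheta_{\frac12,\frac12}(z,i)}{\vartheta_{0,0}(z,i)^3},$$ and it sends $z$ to $P_\infty$ exactly when $\vartheta_{0,0}(z,i)=0$. Under $\jmath$ the form $\varphi$ corresponds to (that is, its pull-back under $\jmath^{-1}$ is) $$2(1-i)\pi\,\vartheta_{0,0}(0,i)^2\,dz=(1-i)\,B(\tfrac14,\tfrac14)\,dz .$$ -/

import Mathlib

noncomputable section

namespace AbelJacobi

/-- The theta function with characteristics
`ϑ_{a,b}(z,τ) = ∑_{n ∈ ℤ} exp(π i (n+a)² τ + 2 π i (n+a)(z+b))`. -/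
def theta (a b : ℚ) (z τ : ℂ) : ℂ :=
  ∑' n : ℤ, Complex.exp
    (Real.pi * Complex.I * ((n : ℂ) + (a : ℂ)) ^ 2 * τ
      + 2 * Real.pi * Complex.I * ((n : ℂ) + (a : ℂ)) * (z + (b : ℂ)))

/-- The lattice `ℤ i + ℤ` in `ℂ`. -/
def lattice : AddSubgroup ℂ :=
  AddSubgroup.zmultiples Complex.I ⊔ AddSubgroup.zmultiples 1

/-- The complex torus `ℂ / (ℤ i + ℤ)`. -/
abbrev Torus : Type := ℂ ⧸ lattice

/-- The affine plane curve `u⁴ = t² (t - 1)`; its only singular point is the node `(0,0)`. -/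
def planeCurve : Set (ℂ × ℂ) := {p | p.2 ^ 4 = p.1 ^ 2 * (p.1 - 1)}

/-- The nonsingular model over the affine plane curve `u⁴ = t² (t - 1)`: the curve in `ℂ³`
with coordinates `(t, u, w)` obtained by adjoining the integral function `w = u² / t`. -/
abbrev AffineModel : Type :=
  {p : ℂ × ℂ × ℂ // p.2.2 ^ 2 = p.1 - 1 ∧ p.2.1 ^ 2 = p.1 * p.2.2}

/-- The nonsingular model of the projective curve `s₂⁴ = s₀ s₁² (s₁ - s₀)`, with its
complex topology. The projective curve has exactly one point with `s₀ = 0`, namely the smooth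
point `[0,1,0]`, so the compact model is the one-point compactification of its affine part. -/
abbrev Model : Type := OnePoint AffineModel

/-- The projection to the plane curve. -/
def AffineModel.proj (p : AffineModel) : ℂ × ℂ := (p.1.1, p.1.2.1)

theorem AffineModel.proj_mem (p : AffineModel) : p.proj ∈ planeCurve := by
  obtain ⟨⟨t, u, w⟩, h1, h2⟩ := p
  simp only [AffineModel.proj, planeCurve, Set.mem_ofPred_eq] at *
  calc u ^ 4 = (u ^ 2) ^ 2 := by ring
    _ = t ^ 2 * (t - 1) := by rw [h2, mul_pow, h1]

/-- Away from the node the projection is bijective. -/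
theorem AffineModel.existsUnique_proj {q : ℂ × ℂ} (hq : q ∈ planeCurve) (h0 : q ≠ (0, 0)) :
    ∃! p : AffineModel, p.proj = q := by
  obtain ⟨t, u⟩ := q
  simp only [planeCurve, Set.mem_ofPred_eq] at hq
  have ht : t ≠ 0 := by
    rintro rfl
    apply h0
    have : u = 0 := by simpa using hq
    rw [this]
  refine ⟨⟨(t, u, u ^ 2 / t), ?_, ?_⟩, rfl, ?_⟩
  · simp only
    field_simp
    linear_combination hq
  · simp only
    field_simp
  · rintro ⟨⟨t', u', w⟩, h1, h2⟩ h
    simp only [AffineModel.proj, Prod.mk.injEq] at h h2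
    obtain ⟨rfl, rfl⟩ := h
    have : w = u' ^ 2 / t' := by
      rw [h2]
      field_simp
    subst this
    rfl

/-- Exactly two points of the model lie over the node. -/
theorem AffineModel.proj_eq_node_iff (p : AffineModel) :
    p.proj = (0, 0) ↔ p.1 = (0, 0, Complex.I) ∨ p.1 = (0, 0, -Complex.I) := by
  obtain ⟨⟨t, u, w⟩, h1, h2⟩ := p
  simp only [AffineModel.proj, Prod.mk.injEq] at *
  constructor
  · rintro ⟨rfl, rfl⟩
    have : w ^ 2 = Complex.I ^ 2 := by rw [h1, Complex.I_sq]; ring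
    rcases sq_eq_sq_iff_eq_or_eq_neg.mp this with h | h <;> simp [h]
  · rintro (⟨rfl, rfl, _⟩ | ⟨rfl, rfl, _⟩) <;> simp

/-- The model is nonsingular: the differentials of its two equations, with respect to
`(t, u, w)`, are linearly independent at each of its points. -/
theorem AffineModel.nonsingular (p : AffineModel) :
    LinearIndependent ℂ ![![-1, 0, 2 * p.1.2.2], ![-p.1.2.2, 2 * p.1.2.1, -p.1.1]] := by
  obtain ⟨⟨t, u, w⟩, h1, h2⟩ := p
  simp only at h1 h2
  rw [LinearIndependent.pair_iff]
  intro a b h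
  have e0 := congrFun h 0
  have e1 := congrFun h 1
  have e2 := congrFun h 2
  simp at e0 e1 e2
  have ha : a = -(b * w) := by linear_combination -e0
  have hb : b = 0 := by
    by_contra hb
    have hu : u = 0 := by
      rcases e1 with h | h
      · exact absurd h hb
      · exact h
    have h3 : b * (t + 2 * w ^ 2) = 0 := by
      rw [ha] at e2
      linear_combination -e2
    have h3' : t + 2 * w ^ 2 = 0 := by
      rcases mul_eq_zero.mp h3 with h | h
      · exact absurd h hb
      · exact h
    have ht : t = 2 / 3 := by linear_combination (1 / 3) * h3' - (2 / 3) * h1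
    subst ht
    have hw : w = 0 := by
      rw [hu] at h2
      linear_combination -(3 / 2) * h2
    rw [hw] at h1
    norm_num at h1
  exact ⟨by rw [ha, hb]; ring, hb⟩

/-- The point `P₁ = (1, 0)`. -/
def basePoint : Model := ((⟨(1, 0, 0), by norm_num, by norm_num⟩ : AffineModel) : Model)

/-- The coordinate function `t`, with a dummy value at the point at infinity (its pole). -/
def tCoord : Model → ℂ
  | none => 0
  | some p => p.1.1

/-- The coordinate function `u`, with a dummy value at the point at infinity (its pole). -/
def uCoord : Model → ℂ
  | none => 0
  | some p => p.1.2.1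

/-- `P` is not one of the points over `t = 0, 1, ∞`; that is, `t` is a local
coordinate at `P` and `P` is not a pole of `t`. -/
def IsUnramified (P : Model) : Prop :=
  ∃ p : AffineModel, P = (p : Model) ∧ p.1.1 ≠ 0 ∧ p.1.1 ≠ 1

/-- The value of the `1`-form `φ = u dt / (t (t - 1))` at an unramified point `P`, on the
tangent vector whose image under `dt` is `v`. -/
def phi (P : Model) (v : ℂ) : ℂ :=
  uCoord P * v / (tCoord P * (tCoord P - 1))

/-- The integrand of `∫_γ φ`. -/
def pathIntegrand {P Q : Model} (γ : Path P Q) (s : ℝ) : ℂ :=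
  phi (γ.extend s) (deriv (fun r : ℝ => tCoord (γ.extend r)) s)

/-- Paths of integration: continuous paths in the compact curve which, except at finitely many
times, stay in the unramified locus and are continuously differentiable
there, and along which the form `φ` is integrable. -/
def IsAdmissible {P Q : Model} (γ : Path P Q) : Prop :=
  (∃ S : Finset ℝ, ∀ s ∈ Set.Ioo (0 : ℝ) 1, s ∉ S →
    IsUnramified (γ.extend s) ∧
    DifferentiableAt ℝ (fun r : ℝ => tCoord (γ.extend r)) s ∧
    ContinuousAt (deriv (fun r : ℝ => tCoord (γ.extend r))) s) ∧
  IntervalIntegrable (pathIntegrand γ) MeasureTheory.volume 0 1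

/-- `∫_γ φ`. -/
def pathIntegral {P Q : Model} (γ : Path P Q) : ℂ :=
  ∫ s in (0 : ℝ)..1, pathIntegrand γ s

/-- `∫_γ φ₁`, where `φ₁ = φ / ((1 - i) B(1/4, 1/4))` is the normalized form. -/
def normalizedIntegral {P Q : Model} (γ : Path P Q) : ℂ :=
  pathIntegral γ / ((1 - Complex.I) * Complex.betaIntegral (1 / 4) (1 / 4))

open Classical in
/-- The Abel-Jacobi map `P ↦ ∫_{P₁}^P φ₁ mod (ℤ i + ℤ)`, computed along some admissible path
from `P₁` to `P`. -/
def abelJacobi (P : Model) : Torus :=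
  if h : ∃ γ : Path basePoint P, IsAdmissible γ then
    ((normalizedIntegral h.choose : ℂ) : Torus)
  else 0

end AbelJacobi

end

noncomputable section

namespace AbelJacobi

open Complex Filter Topology

/-! ### Theta functions with characteristics -/

/-! The Abel-Jacobi map is inverted rather than studied directly. The theta quotients `tFun`,
`uFun`, `wFun` define a map `param` from ℂ to the curve. It is well defined because i is fixed by τ
↦ -1/τ: this forces θ₀₁(0) = θ₁₀(0), hence the quartic relation `th_quartic`, which is the equation
of the curve.

The zeros of the four theta functions are the lattice and its half-period translates. With these,
`param` descends to a continuous bijection from the compact torus to the curve: injectivity comes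
from the addition formula, surjectivity from Liouville's theorem. It is therefore a homeomorphism,
`torusHomeo`.

In this parametrization φ is a constant multiple of dz. Indeed t' = period · w · u, by a Wronskian
computation, the duplication formula `th11_two_mul` and Jacobi's derivative formula, while φ = dt /
(w u) on the curve. A path from P₁ lifts to ℂ through the covering of the torus, and along it the
integral of φ is `period` times the endpoint of the lift. So the value modulo the lattice depends
only on P, and the Abel-Jacobi map is the inverse of `torusHomeo`.

The value of `period` in terms of B(1/4, 1/4) comes from restricting to the real segment [0, 1/2],
where θ₁₁² / θ₀₀² satisfies a first-order differential equation that turns a beta integral into the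
integral of a constant. -/

/-- The general term of the series of `theta`. -/
def thetaTerm (a b : ℚ) (z τ : ℂ) (n : ℤ) : ℂ :=
  Complex.exp
    (Real.pi * Complex.I * ((n : ℂ) + (a : ℂ)) ^ 2 * τ
      + 2 * Real.pi * Complex.I * ((n : ℂ) + (a : ℂ)) * (z + (b : ℂ)))

lemma theta_eq_tsum (a b : ℚ) (z τ : ℂ) : theta a b z τ = ∑' n, thetaTerm a b z τ n := rfl

lemma thetaTerm_eq (a b : ℚ) (z τ : ℂ) (n : ℤ) :
    thetaTerm a b z τ n = cexp (Real.pi * I * a ^ 2 * τ + 2 * Real.pi * I * a * (z + b))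
      * jacobiTheta₂_term n (z + b + a * τ) τ := by
  rw [thetaTerm, jacobiTheta₂_term, ← Complex.exp_add]
  congr 1
  ring

lemma theta_eq (a b : ℚ) (z τ : ℂ) :
    theta a b z τ = cexp (Real.pi * I * a ^ 2 * τ + 2 * Real.pi * I * a * (z + b))
      * jacobiTheta₂ (z + b + a * τ) τ := by
  rw [theta_eq_tsum, jacobiTheta₂, ← tsum_mul_left]
  exact tsum_congr fun n => thetaTerm_eq a b z τ n

lemma summable_thetaTerm (a b : ℚ) (z : ℂ) {τ : ℂ} (hτ : 0 < τ.im) :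
    Summable (thetaTerm a b z τ) := by
  rw [show thetaTerm a b z τ = _ from funext (thetaTerm_eq a b z τ)]
  exact ((summable_jacobiTheta₂_term_iff _ _).2 hτ).mul_left _

lemma differentiable_theta (a b : ℚ) {τ : ℂ} (hτ : 0 < τ.im) :
    Differentiable ℂ (fun z => theta a b z τ) := by
  intro z
  simp only [theta_eq]
  refine DifferentiableAt.mul (by fun_prop) ?_
  exact DifferentiableAt.comp (g := fun z => jacobiTheta₂ z τ) z
    (differentiableAt_jacobiTheta₂_fst _ hτ) (by fun_prop)

lemma theta_char_add_one (a b : ℚ) (z τ : ℂ) : theta (a + 1) b z τ = theta a b z τ := by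
  rw [theta_eq_tsum, theta_eq_tsum, ← (Equiv.addRight (1 : ℤ)).tsum_eq (thetaTerm a b z τ)]
  refine tsum_congr fun n => ?_
  simp only [thetaTerm, Equiv.coe_addRight]
  push_cast
  ring_nf

lemma theta_char_add_one' (a b : ℚ) (z τ : ℂ) :
    theta a (b + 1) z τ = cexp (2 * Real.pi * I * a) * theta a b z τ := by
  rw [theta_eq_tsum, theta_eq_tsum, ← tsum_mul_left]
  refine tsum_congr fun n => ?_
  simp only [thetaTerm]
  rw [← Complex.exp_add, Complex.exp_eq_exp_iff_exists_int]
  refine ⟨n, ?_⟩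
  push_cast
  ring

lemma theta_add_one (a b : ℚ) (z τ : ℂ) :
    theta a b (z + 1) τ = cexp (2 * Real.pi * I * a) * theta a b z τ := by
  rw [← theta_char_add_one', theta_eq_tsum, theta_eq_tsum]
  refine tsum_congr fun n => ?_
  simp only [thetaTerm]
  push_cast
  ring_nf

/-- Completing the square turns the translation by τ into the shift a ↦ a + 1, which only reindexes
the series. -/
lemma theta_add_tau (a b : ℚ) (z τ : ℂ) :
    theta a b (z + τ) τ
      = cexp (-(Real.pi * I * τ) - 2 * Real.pi * I * (z + b)) * theta a b z τ := by
  rw [← theta_char_add_one a b z, theta_eq_tsum, theta_eq_tsum, ← tsum_mul_left]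
  refine tsum_congr fun n => ?_
  simp only [thetaTerm]
  rw [← Complex.exp_add]
  push_cast
  ring_nf

lemma theta_neg (a b : ℚ) (z τ : ℂ) : theta a b (-z) τ = theta (-a) (-b) z τ := by
  rw [theta_eq_tsum, theta_eq_tsum, ← (Equiv.neg ℤ).tsum_eq]
  refine tsum_congr fun n => ?_
  simp only [thetaTerm, Equiv.neg_apply]
  push_cast
  ring_nf

/-! ### The addition formula -/

/-- Pairs of integers, split according to the parity of their sum. -/
def paritySplit : (ℤ × ℤ) ⊕ (ℤ × ℤ) ≃ ℤ × ℤ where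
  toFun := Sum.elim (fun p => (p.1 + p.2, p.1 - p.2)) (fun p => (p.1 + p.2 + 1, p.1 - p.2))
  invFun p := if (p.1 + p.2) % 2 = 0 then Sum.inl ((p.1 + p.2) / 2, (p.1 - p.2) / 2)
    else Sum.inr ((p.1 + p.2) / 2, (p.1 - p.2) / 2)
  left_inv := by
    rintro (⟨p, q⟩ | ⟨p, q⟩)
    · have h : (p + q + (p - q)) % 2 = 0 := by omega
      simp only [Sum.elim_inl, h, if_true, Sum.inl.injEq, Prod.mk.injEq]
      omega
    · have h : (p + q + 1 + (p - q)) % 2 ≠ 0 := by omega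
      simp only [Sum.elim_inr, h, if_false, Sum.inr.injEq, Prod.mk.injEq]
      omega
  right_inv := by
    rintro ⟨m, n⟩
    by_cases h : (m + n) % 2 = 0
    · simp only [h, if_true, Sum.elim_inl, Prod.mk.injEq]
      omega
    · simp only [h, if_false, Sum.elim_inr, Prod.mk.injEq]
      omega

lemma tsum_parity_split {f : ℤ × ℤ → ℂ} (hf : Summable f) :
    ∑' p, f p = ∑' p : ℤ × ℤ, f (p.1 + p.2, p.1 - p.2)
      + ∑' p : ℤ × ℤ, f (p.1 + p.2 + 1, p.1 - p.2) := by
  have h : Summable (f ∘ paritySplit) := paritySplit.summable_iff.2 hf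
  rw [← paritySplit.tsum_eq f]
  exact Summable.tsum_sum (f := f ∘ paritySplit)
    (h.comp_injective Sum.inl_injective) (h.comp_injective Sum.inr_injective)

lemma theta_mul_theta_eq_tsum (a b a' b' : ℚ) (x y : ℂ) {τ : ℂ} (hτ : 0 < τ.im) :
    Summable (fun p : ℤ × ℤ => thetaTerm a b x τ p.1 * thetaTerm a' b' y τ p.2) ∧
    theta a b x τ * theta a' b' y τ
      = ∑' p : ℤ × ℤ, thetaTerm a b x τ p.1 * thetaTerm a' b' y τ p.2 := by
  have h1 := (summable_thetaTerm a b x hτ).norm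
  have h2 := (summable_thetaTerm a' b' y hτ).norm
  exact ⟨summable_mul_of_summable_norm h1 h2, tsum_mul_tsum_of_summable_norm h1 h2⟩

/-- The addition formula for theta functions with characteristics. -/
theorem theta_add_mul_theta_sub (a b a' b' : ℚ) (x y : ℂ) {τ : ℂ} (hτ : 0 < τ.im) :
    theta a b (x + y) τ * theta a' b' (x - y) τ
      = theta ((a + a') / 2) (b + b') (2 * x) (2 * τ)
          * theta ((a - a') / 2) (b - b') (2 * y) (2 * τ)
        + theta ((a + a' + 1) / 2) (b + b') (2 * x) (2 * τ)
          * theta ((a - a' + 1) / 2) (b - b') (2 * y) (2 * τ) := by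
  have hτ2 : 0 < (2 * τ).im := by simpa using hτ
  obtain ⟨hs, h⟩ := theta_mul_theta_eq_tsum a b a' b' (x + y) (x - y) hτ
  -- With m = p + q and n = p - q the quadratic form diagonalizes: (m + a)² + (n + a')² = 2 (p + (a
  -- + a')/2)² + 2 (q + (a - a')/2)². Pairs of odd sum move both characteristics by 1/2.
  rw [h, tsum_parity_split hs, (theta_mul_theta_eq_tsum _ _ _ _ (2 * x) (2 * y) hτ2).2,
    (theta_mul_theta_eq_tsum _ _ _ _ (2 * x) (2 * y) hτ2).2]
  congr 1 <;>
  · refine tsum_congr fun p => ?_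
    simp only [thetaTerm]
    rw [← Complex.exp_add, ← Complex.exp_add]
    congr 1
    push_cast
    ring

/-! ### Half-integer characteristics: parity and cases of the addition formula -/

lemma theta_half_one (b : ℚ) (z τ : ℂ) : theta (1 / 2) (b + 1) z τ = -theta (1 / 2) b z τ := by
  rw [theta_char_add_one']
  have : cexp (2 * Real.pi * I * ((1 / 2 : ℚ) : ℂ)) = -1 := by
    rw [← Complex.exp_pi_mul_I]
    push_cast
    ring_nf
  rw [this, neg_one_mul]

lemma theta_zero_one (b : ℚ) (z τ : ℂ) : theta 0 (b + 1) z τ = theta 0 b z τ := by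
  simp [theta_char_add_one']

lemma theta_zero_half_neg (z τ : ℂ) : theta 0 (1 / 2) (-z) τ = theta 0 (1 / 2) z τ := by
  rw [theta_neg, neg_zero, ← theta_zero_one (-(1 / 2))]
  norm_num

lemma theta_zero_zero_neg (z τ : ℂ) : theta 0 0 (-z) τ = theta 0 0 z τ := by
  rw [theta_neg]
  norm_num

lemma theta_half_zero_neg (z τ : ℂ) : theta (1 / 2) 0 (-z) τ = theta (1 / 2) 0 z τ := by
  rw [theta_neg, ← theta_char_add_one]
  norm_num

lemma theta_half_half_neg (z τ : ℂ) :
    theta (1 / 2) (1 / 2) (-z) τ = -theta (1 / 2) (1 / 2) z τ := by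
  rw [theta_neg, ← theta_char_add_one, ← neg_neg (theta (-(1 / 2) + 1) _ _ _),
    show (-(1 / 2) + 1 : ℚ) = 1 / 2 by norm_num, ← theta_half_one]
  norm_num

lemma theta_half_half_zero (τ : ℂ) : theta (1 / 2) (1 / 2) 0 τ = 0 := by
  have h := theta_half_half_neg 0 τ
  rw [neg_zero] at h
  exact self_eq_neg.1 h

lemma theta_one (b : ℚ) (z τ : ℂ) : theta 1 b z τ = theta 0 b z τ := by
  simpa using theta_char_add_one 0 b z τ

section Addition

variable {τ : ℂ} (hτ : 0 < τ.im) (x y : ℂ)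
include hτ

lemma theta_addition_zero_zero :
    theta 0 0 (x + y) τ * theta 0 0 (x - y) τ
      = theta 0 0 (2 * x) (2 * τ) * theta 0 0 (2 * y) (2 * τ)
        + theta (1 / 2) 0 (2 * x) (2 * τ) * theta (1 / 2) 0 (2 * y) (2 * τ) := by
  simpa using theta_add_mul_theta_sub 0 0 0 0 x y hτ

lemma theta_addition_zero_half :
    theta 0 (1 / 2) (x + y) τ * theta 0 (1 / 2) (x - y) τ
      = theta 0 0 (2 * x) (2 * τ) * theta 0 0 (2 * y) (2 * τ)
        - theta (1 / 2) 0 (2 * x) (2 * τ) * theta (1 / 2) 0 (2 * y) (2 * τ) := by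
  have h := theta_add_mul_theta_sub 0 (1 / 2) 0 (1 / 2) x y hτ
  rw [sub_self, sub_self, add_zero, zero_div, zero_add (1 : ℚ),
    show (1 / 2 + 1 / 2 : ℚ) = 0 + 1 by norm_num, theta_half_one, theta_zero_one] at h
  rw [h]
  ring

lemma theta_addition_half_zero :
    theta (1 / 2) 0 (x + y) τ * theta (1 / 2) 0 (x - y) τ
      = theta (1 / 2) 0 (2 * x) (2 * τ) * theta 0 0 (2 * y) (2 * τ)
        + theta 0 0 (2 * x) (2 * τ) * theta (1 / 2) 0 (2 * y) (2 * τ) := by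
  have h := theta_add_mul_theta_sub (1 / 2) 0 (1 / 2) 0 x y hτ
  rw [show ((1 / 2 + 1 / 2 : ℚ) / 2) = 1 / 2 by norm_num, sub_self, sub_self, zero_div, add_zero,
    show ((1 / 2 + 1 / 2 + 1 : ℚ) / 2) = 1 by norm_num,
    show ((0 + 1 : ℚ) / 2) = 1 / 2 by norm_num, theta_one] at h
  exact h

lemma theta_addition_half_half :
    theta (1 / 2) (1 / 2) (x + y) τ * theta (1 / 2) (1 / 2) (x - y) τ
      = theta 0 0 (2 * x) (2 * τ) * theta (1 / 2) 0 (2 * y) (2 * τ)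
        - theta (1 / 2) 0 (2 * x) (2 * τ) * theta 0 0 (2 * y) (2 * τ) := by
  have h := theta_add_mul_theta_sub (1 / 2) (1 / 2) (1 / 2) (1 / 2) x y hτ
  rw [show ((1 / 2 + 1 / 2 : ℚ) / 2) = 1 / 2 by norm_num, sub_self, zero_div,
    show ((1 / 2 + 1 / 2 + 1 : ℚ) / 2) = 1 by norm_num,
    show ((0 + 1 : ℚ) / 2) = 1 / 2 by norm_num, theta_one,
    show (1 / 2 + 1 / 2 : ℚ) = 0 + 1 by norm_num, theta_half_one, theta_zero_one] at h
  rw [h]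
  ring

/-- Taking y = 0 with unequal characteristics makes the odd theta constant, which is zero, appear in
one of the two terms; a single product at 2τ remains. -/
lemma theta_half_zero_mul_theta_half_half :
    theta (1 / 2) 0 x τ * theta (1 / 2) (1 / 2) x τ
      = theta (1 / 2) (1 / 2) (2 * x) (2 * τ) * theta 0 (1 / 2) 0 (2 * τ) := by
  have h := theta_add_mul_theta_sub (1 / 2) (1 / 2) (1 / 2) 0 x 0 hτ
  rw [show ((1 / 2 + 1 / 2 : ℚ) / 2) = 1 / 2 by norm_num, sub_self, zero_div,
    show ((0 + 1 : ℚ) / 2) = 1 / 2 by norm_num, sub_zero, mul_zero, add_zero, add_zero, sub_zero,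
    theta_half_half_zero, mul_zero, add_zero] at h
  rw [mul_comm, h]

lemma theta_zero_zero_mul_theta_zero_half :
    theta 0 0 x τ * theta 0 (1 / 2) x τ
      = theta 0 (1 / 2) (2 * x) (2 * τ) * theta 0 (1 / 2) 0 (2 * τ) := by
  have h := theta_add_mul_theta_sub 0 (1 / 2) 0 0 x 0 hτ
  rw [sub_self, add_zero, add_zero, zero_div, zero_add,
    sub_zero, mul_zero, add_zero, sub_zero,
    theta_half_half_zero, mul_zero, add_zero] at h
  rw [mul_comm, h]

end Addition

/-! ### Zeros of the theta functions at `τ = i` -/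

lemma norm_cos_le (z : ℂ) : ‖Complex.cos z‖ ≤ Real.exp |z.im| := by
  rw [Complex.cos, norm_div, Complex.norm_two, div_le_iff₀ two_pos]
  refine (norm_add_le _ _).trans ?_
  rw [Complex.norm_exp, Complex.norm_exp]
  have h1 : Real.exp (z * I).re ≤ Real.exp |z.im| := by
    rw [Real.exp_le_exp]
    simpa using neg_le_abs z.im
  have h2 : Real.exp (-z * I).re ≤ Real.exp |z.im| := by
    rw [Real.exp_le_exp]
    simpa using le_abs_self z.im
  linarith

/-- Keeping the factor ‖sin z‖ in the bound is what lets the tail of the sine series of θ₁₁ be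
compared with its leading term. -/
lemma norm_sin_odd_mul_le (z : ℂ) (n : ℕ) :
    ‖Complex.sin ((2 * n + 1) * z)‖
      ≤ (2 * n + 1) * Real.exp (2 * n * |z.im|) * ‖Complex.sin z‖ := by
  induction n with
  | zero => simp
  | succ n ih =>
    have h : Complex.sin ((2 * (n + 1 : ℕ) + 1) * z)
        = Complex.sin ((2 * n + 1) * z)
          + 2 * Complex.cos ((2 * n + 2) * z) * Complex.sin z := by
      have h1 : (2 * (n + 1 : ℕ) + 1) * z = (2 * n + 2) * z + z := by push_cast; ring
      have h2 : (2 * n + 1) * z = (2 * n + 2) * z - z := by ring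
      rw [h1, h2, Complex.sin_add, Complex.sin_sub]
      ring
    have hc : ‖Complex.cos ((2 * n + 2) * z)‖ ≤ Real.exp (2 * (n + 1 : ℕ) * |z.im|) := by
      refine (norm_cos_le _).trans (Real.exp_le_exp.2 (le_of_eq ?_))
      have : ((2 * n + 2) * z).im = (2 * (n + 1 : ℕ)) * z.im := by
        rw [show ((2 * n + 2) * z : ℂ) = ((2 * (n + 1 : ℕ) : ℝ) : ℂ) * z by push_cast; ring,
          Complex.im_ofReal_mul]
      rw [this, abs_mul, abs_of_nonneg (by positivity)]
    have he : Real.exp (2 * n * |z.im|) ≤ Real.exp (2 * (n + 1 : ℕ) * |z.im|) := by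
      rw [Real.exp_le_exp]
      push_cast
      nlinarith [abs_nonneg z.im]
    rw [h]
    refine (norm_add_le _ _).trans ?_
    rw [norm_mul, norm_mul, Complex.norm_two]
    calc _ ≤ (2 * n + 1) * Real.exp (2 * (n + 1 : ℕ) * |z.im|) * ‖Complex.sin z‖
          + 2 * Real.exp (2 * (n + 1 : ℕ) * |z.im|) * ‖Complex.sin z‖ := by
          gcongr
          exact ih.trans (by gcongr)
      _ = _ := by push_cast; ring

lemma thetaTerm_half_half_pair (z : ℂ) (n : ℕ) :
    thetaTerm (1 / 2) (1 / 2) z I n + thetaTerm (1 / 2) (1 / 2) z I (-(n + 1))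
      = -2 * (-1) ^ n * cexp (-Real.pi * (n + 1 / 2) ^ 2)
        * Complex.sin ((2 * n + 1) * (Real.pi * z)) := by
  have e1 : cexp (Real.pi * I * (n + 1 / 2)) = I * (-1) ^ n := by
    rw [show (Real.pi * I * (n + 1 / 2) : ℂ) = n * (Real.pi * I) + Real.pi / 2 * I by ring,
      Complex.exp_add, Complex.exp_nat_mul, Complex.exp_pi_mul_I, Complex.exp_pi_div_two_mul_I,
      mul_comm]
  have e2 : cexp (-(Real.pi * I * (n + 1 / 2))) = -(I * (-1) ^ n) := by
    rw [Complex.exp_neg, e1, mul_inv, Complex.inv_I, ← inv_pow]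
    norm_num
  have h1 : thetaTerm (1 / 2) (1 / 2) z I n = cexp (-Real.pi * (n + 1 / 2) ^ 2)
      * cexp ((2 * n + 1) * (Real.pi * z) * I) * cexp (Real.pi * I * (n + 1 / 2)) := by
    rw [thetaTerm, ← Complex.exp_add, ← Complex.exp_add]
    congr 1
    push_cast
    linear_combination ((n : ℂ) + 1 / 2) ^ 2 * Real.pi * Complex.I_sq
  have h2 : thetaTerm (1 / 2) (1 / 2) z I (-(n + 1)) = cexp (-Real.pi * (n + 1 / 2) ^ 2)
      * cexp (-((2 * n + 1) * (Real.pi * z)) * I) * cexp (-(Real.pi * I * (n + 1 / 2))) := by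
    rw [thetaTerm, ← Complex.exp_add, ← Complex.exp_add]
    congr 1
    push_cast
    linear_combination ((n : ℂ) + 1 / 2) ^ 2 * Real.pi * Complex.I_sq
  rw [h1, h2, e1, e2, Complex.sin]
  ring

/-- Since (n + 3/2)² - (n + 1) = (n + 1)² + 1/4, the exponentials decay at least like e^(-3(n+1)) ≤
12^(-(n+1)). The linear factor is at most 3^(n+1) by Bernoulli, leaving ratio 1/4. -/
lemma coeff_bound (n : ℕ) :
    (2 * (n + 1 : ℕ) + 1) * Real.exp (-Real.pi * ((n + 1 : ℕ) + 1 / 2) ^ 2)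
        * Real.exp (2 * (n + 1 : ℕ) * (Real.pi / 2))
      ≤ Real.exp (-Real.pi * (1 / 2) ^ 2) * (1 / 4 * (1 / 4) ^ n) := by
  have hpi := Real.pi_gt_three
  have h1 : Real.exp (-Real.pi * ((n + 1 : ℕ) + 1 / 2) ^ 2)
        * Real.exp (2 * (n + 1 : ℕ) * (Real.pi / 2))
      ≤ Real.exp (-Real.pi * (1 / 2) ^ 2) * (Real.exp (-3)) ^ (n + 1) := by
    rw [← Real.exp_nat_mul, ← Real.exp_add, ← Real.exp_add, Real.exp_le_exp]
    push_cast
    have hn : (0 : ℝ) ≤ n := n.cast_nonneg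
    nlinarith [mul_nonneg hn hn, mul_nonneg hn (mul_nonneg hn (sub_nonneg.2 hpi.le)),
      mul_nonneg hn (sub_nonneg.2 hpi.le)]
  have h2 : Real.exp (-3) ≤ 1 / 12 := by
    rw [Real.exp_neg, inv_eq_one_div]
    apply one_div_le_one_div_of_le (by norm_num)
    have : (2.7 : ℝ) ^ 3 ≤ Real.exp 1 ^ 3 := by
      gcongr
      linarith [Real.exp_one_gt_d9]
    rw [← Real.exp_nat_mul] at this
    norm_num at this
    linarith
  have h3 : (2 * (n + 1 : ℕ) + 1 : ℝ) ≤ 3 ^ (n + 1) := by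
    have := one_add_mul_le_pow (show (-2 : ℝ) ≤ 2 by norm_num) (n + 1)
    norm_num at this ⊢
    linarith
  calc _ = (2 * (n + 1 : ℕ) + 1) * (Real.exp (-Real.pi * ((n + 1 : ℕ) + 1 / 2) ^ 2)
        * Real.exp (2 * (n + 1 : ℕ) * (Real.pi / 2))) := by ring
    _ ≤ 3 ^ (n + 1) * (Real.exp (-Real.pi * (1 / 2) ^ 2) * (1 / 12) ^ (n + 1)) := by
        refine mul_le_mul h3 (h1.trans ?_) (by positivity) (by positivity)
        gcongr
    _ = _ := by
        rw [show (1 / 12 : ℝ) = 1 / 4 * (1 / 3) by norm_num, mul_pow, ← pow_succ', one_div 3,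
          inv_pow]
        field_simp

/-- In the sine series the leading term has norm 2c‖s‖, with s = sin(πz), and the tail is at most
2c‖s‖ · (1/4)/(1 - 1/4) = 2c‖s‖/3. They can cancel only if s = 0. -/
lemma sin_eq_zero_of_theta_half_half_eq_zero {z : ℂ} (hz : |z.im| ≤ 1 / 2)
    (h : theta (1 / 2) (1 / 2) z I = 0) : Complex.sin (Real.pi * z) = 0 := by
  have hs : HasSum (fun n : ℕ => -2 * (-1) ^ n * cexp (-Real.pi * (n + 1 / 2) ^ 2)
      * Complex.sin ((2 * n + 1) * (Real.pi * z))) 0 := by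
    have := (summable_thetaTerm (1 / 2) (1 / 2) z (τ := I) (by simp)).hasSum.nat_add_neg_add_one
    rw [← theta_eq_tsum, h] at this
    simpa only [thetaTerm_half_half_pair] using this
  have him : |((Real.pi : ℂ) * z).im| ≤ Real.pi / 2 := by
    rw [Complex.im_ofReal_mul, abs_mul, abs_of_pos Real.pi_pos]
    nlinarith [Real.pi_pos]
  set s := Complex.sin (Real.pi * z) with hsdef
  set c := Real.exp (-Real.pi * (1 / 2) ^ 2) with hc
  have hnorm : ∀ x : ℝ, ‖cexp (-Real.pi * (x + 1 / 2) ^ 2)‖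
      = Real.exp (-Real.pi * (x + 1 / 2) ^ 2) := by
    intro x
    rw [show (-Real.pi * (x + 1 / 2) ^ 2 : ℂ) = ((-Real.pi * (x + 1 / 2) ^ 2 : ℝ) : ℂ) by
      push_cast; ring, ← Complex.ofReal_exp, Complex.norm_real, Real.norm_of_nonneg (by positivity)]
  have hbound : ∀ n : ℕ, ‖-2 * (-1) ^ (n + 1) * cexp (-Real.pi * ((n + 1 : ℕ) + 1 / 2) ^ 2)
      * Complex.sin ((2 * (n + 1 : ℕ) + 1) * (Real.pi * z))‖
      ≤ 2 * c * ‖s‖ / 4 * (1 / 4) ^ n := by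
    intro n
    have h1 := norm_sin_odd_mul_le (Real.pi * z) (n + 1)
    have h2 : Real.exp (2 * (n + 1 : ℕ) * |((Real.pi : ℂ) * z).im|)
        ≤ Real.exp (2 * (n + 1 : ℕ) * (Real.pi / 2)) := by
      gcongr
    have h3 := hnorm (n + 1 : ℕ)
    push_cast at h1 h2 h3 ⊢
    rw [norm_mul, norm_mul, norm_mul, norm_pow, norm_neg, norm_neg, norm_one, one_pow,
      Complex.norm_two, mul_one, h3]
    have h4 := coeff_bound n
    push_cast at h4
    calc _ ≤ 2 * Real.exp (-Real.pi * (n + 1 + 1 / 2) ^ 2) *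
          ((2 * (n + 1) + 1) * Real.exp (2 * (n + 1) * (Real.pi / 2)) * ‖s‖) := by
          gcongr
          exact h1.trans (by gcongr)
      _ = 2 * ‖s‖ * ((2 * (n + 1) + 1) * Real.exp (-Real.pi * (n + 1 + 1 / 2) ^ 2)
          * Real.exp (2 * (n + 1) * (Real.pi / 2))) := by ring
      _ ≤ 2 * ‖s‖ * (c * (1 / 4 * (1 / 4) ^ n)) := by gcongr
      _ = _ := by ring
  have hg : HasSum (fun n : ℕ => 2 * c * ‖s‖ / 4 * (1 / 4 : ℝ) ^ n)
      (2 * c * ‖s‖ / 4 * (1 - 1 / 4)⁻¹) :=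
    (hasSum_geometric_of_lt_one (by norm_num) (by norm_num)).mul_left _
  have htail := (hasSum_nat_add_iff' 1).2 hs
  have hle := htail.tsum_eq ▸ tsum_of_norm_bounded hg hbound
  have h0 := hnorm 0
  simp only [Finset.range_one, Finset.sum_singleton, zero_sub, norm_neg, norm_mul, pow_zero,
    Nat.cast_zero, mul_zero, zero_add, one_mul, mul_one, Complex.norm_two] at hle
  simp only [Complex.ofReal_zero, zero_add] at h0
  rw [h0, ← hc, ← hsdef] at hle
  have hcpos : 0 < c := Real.exp_pos _
  have : c * ‖s‖ ≤ 0 := by norm_num at hle; linarith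
  have h5 : ‖s‖ ≤ 0 := by
    by_contra hcon
    push Not at hcon
    nlinarith [mul_pos hcpos hcon]
  exact norm_le_zero_iff.1 h5

lemma mem_lattice {z : ℂ} : z ∈ lattice ↔ ∃ m n : ℤ, z = m + n * I := by
  rw [lattice, AddSubgroup.mem_sup]
  simp only [AddSubgroup.mem_zmultiples_iff, exists_exists_eq_and, zsmul_eq_mul, mul_one]
  constructor
  · rintro ⟨n, m, h⟩
    exact ⟨m, n, by rw [← h]; ring⟩
  · rintro ⟨m, n, h⟩
    exact ⟨n, m, by rw [h]; ring⟩

lemma one_mem_lattice : (1 : ℂ) ∈ lattice := mem_lattice.2 ⟨1, 0, by simp⟩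

/-- Periodicity with respect to `1` and `i` implies periodicity with respect to the lattice. -/
lemma periodic_lattice {α : Type*} {f : ℂ → α} (h1 : ∀ z, f (z + 1) = f z)
    (hI : ∀ z, f (z + I) = f z) {l : ℂ} (hl : l ∈ lattice) (z : ℂ) : f (z + l) = f z := by
  obtain ⟨m, n, rfl⟩ := mem_lattice.1 hl
  have h1' : Function.Periodic f 1 := h1
  have hI' : Function.Periodic f I := hI
  have a := h1'.int_mul m z
  have b := hI'.int_mul n (z + m)
  rw [mul_one] at a
  rw [← add_assoc, b, a]

/-- Every point is congruent modulo the lattice to a point of the unit square around `0`. -/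
lemma exists_lattice_sub (z : ℂ) :
    ∃ l ∈ lattice, |(z - l).re| ≤ 1 / 2 ∧ |(z - l).im| ≤ 1 / 2 := by
  refine ⟨round z.re + round z.im * I, mem_lattice.2 ⟨_, _, rfl⟩, ?_, ?_⟩
  · simpa using abs_sub_round z.re
  · simpa using abs_sub_round z.im

lemma theta_add_mem_lattice_eq_zero_iff (a b : ℚ) (z : ℂ) {l : ℂ} (hl : l ∈ lattice) :
    theta a b (z + l) I = 0 ↔ theta a b z I = 0 := by
  have := periodic_lattice (f := fun z => theta a b z I = 0)
    (fun z => by simp [theta_add_one]) (fun z => by simp [theta_add_tau]) hl z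
  exact iff_of_eq this

/-- The zero set is lattice-invariant, so z may be moved to |Im z| ≤ 1/2, where only zeros of
sin(πz), that is integers, are possible. -/
theorem theta_half_half_eq_zero_iff (z : ℂ) :
    theta (1 / 2) (1 / 2) z I = 0 ↔ z ∈ lattice := by
  constructor
  · intro h
    obtain ⟨l, hl, -, him⟩ := exists_lattice_sub z
    have h' : theta (1 / 2) (1 / 2) (z - l) I = 0 := by
      rw [sub_eq_add_neg, theta_add_mem_lattice_eq_zero_iff _ _ _ (neg_mem hl), h]
    obtain ⟨k, hk⟩ := Complex.sin_eq_zero_iff.1 (sin_eq_zero_of_theta_half_half_eq_zero him h')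
    have hk' : z - l = k := by
      have hpi : (Real.pi : ℂ) ≠ 0 := by exact_mod_cast Real.pi_ne_zero
      apply mul_left_cancel₀ hpi
      rw [hk, mul_comm]
    rw [← sub_add_cancel z l, hk']
    exact add_mem (mem_lattice.2 ⟨k, 0, by simp⟩) hl
  · intro h
    rw [← zero_add z, theta_add_mem_lattice_eq_zero_iff _ _ _ h, theta_half_half_zero]

/-- Changing the characteristic translates z by a half period, up to a nonvanishing exponential. -/
lemma theta_eq_zero_iff (a b : ℚ) (z : ℂ) :
    theta a b z I = 0 ↔ z + (b - 1 / 2) + (a - 1 / 2) * I ∈ lattice := by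
  rw [← theta_half_half_eq_zero_iff, theta_eq, theta_eq, mul_eq_zero, mul_eq_zero]
  simp only [Complex.exp_ne_zero, false_or]
  push_cast
  ring_nf

/-! ### Jacobi's derivative formula -/

/-- Dominated convergence, with the series at T = 1 as majorant: only the terms of exponent zero
survive at the cusp. -/
lemma tendsto_tsum_mul_cexp {c : ℤ → ℂ} {e : ℤ → ℤ} (he : ∀ n, 0 ≤ e n)
    (hs : Summable fun n => c n * cexp (-(Real.pi * e n))) :
    Tendsto (fun T : ℝ => ∑' n, c n * cexp (-(Real.pi * T * e n))) atTop
      (𝓝 (∑' n, if e n = 0 then c n else 0)) := by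
  have hnorm : ∀ (T : ℝ) (n : ℤ), ‖cexp (-(Real.pi * T * e n))‖
      = Real.exp (-(Real.pi * e n) * T) := by
    intro T n
    rw [show (-(Real.pi * T * e n) : ℂ) = ((-(Real.pi * e n) * T : ℝ) : ℂ) by push_cast; ring,
      ← Complex.ofReal_exp, Complex.norm_real, Real.norm_of_nonneg (by positivity)]
  refine tendsto_tsum_of_dominated_convergence hs.norm (fun n => ?_) ?_
  · split_ifs with h
    · simp [h]
    · rw [← mul_zero (c n)]
      refine Tendsto.const_mul _ ?_
      rw [tendsto_zero_iff_norm_tendsto_zero]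
      simp only [hnorm]
      refine Real.tendsto_exp_atBot.comp (tendsto_id.const_mul_atTop_of_neg ?_)
      have : (0 : ℝ) < e n := by exact_mod_cast lt_of_le_of_ne (he n) (Ne.symm h)
      nlinarith [Real.pi_pos]
  · filter_upwards [eventually_ge_atTop 1] with T hT n
    have h1 := hnorm 1 n
    rw [Complex.ofReal_one, mul_one, mul_one] at h1
    rw [norm_mul, norm_mul, hnorm, h1]
    have : (0 : ℝ) ≤ e n := by exact_mod_cast he n
    gcongr
    nlinarith [mul_nonneg Real.pi_pos.le this]

lemma mul_succ_self_nonneg (n : ℤ) : 0 ≤ n * (n + 1) := by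
  rcases le_or_gt 0 n with h | h
  · positivity
  · nlinarith

lemma tsum_ite_mul_succ_self_eq_zero (c : ℤ → ℂ) :
    ∑' n : ℤ, (if n * (n + 1) = 0 then c n else 0) = c 0 + c (-1) := by
  rw [tsum_eq_sum (s := {0, -1})]
  · simp
  · intro n hn
    rw [if_neg]
    intro h
    apply hn
    rcases mul_eq_zero.1 h with h | h
    · simp [h]
    · simp [eq_neg_of_add_eq_zero_left h]

lemma theta_zero_left (b : ℚ) (τ : ℂ) : theta 0 b 0 τ = jacobiTheta₂ b τ := by
  simp [theta_eq]

lemma theta_half_zero_zero (τ : ℂ) :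
    theta (1 / 2) 0 0 τ = cexp (Real.pi * I * τ / 4) * jacobiTheta₂ (τ / 2) τ := by
  rw [theta_eq]
  push_cast
  ring_nf

/-- The derivative at `0` of the odd theta function. -/
def thetaDeriv (τ : ℂ) : ℂ := deriv (fun z => theta (1 / 2) (1 / 2) z τ) 0

lemma hasDerivAt_theta_half_half_zero {τ : ℂ} (hτ : 0 < τ.im) :
    HasDerivAt (fun z => theta (1 / 2) (1 / 2) z τ) (thetaDeriv τ) 0 :=
  (differentiable_theta _ _ hτ 0).hasDerivAt

/-- The Jacobi theta factor vanishes at the half period, so the derivative of the exponential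
prefactor does not contribute. -/
lemma thetaDeriv_eq {τ : ℂ} (hτ : 0 < τ.im) :
    thetaDeriv τ = cexp (Real.pi * I * τ / 4) * I * jacobiTheta₂' (1 / 2 + τ / 2) τ := by
  have h0 : jacobiTheta₂ (1 / 2 + τ / 2) τ = 0 := by
    have h := theta_half_half_zero τ
    rw [theta_eq, mul_eq_zero] at h
    have h := h.resolve_left (Complex.exp_ne_zero _)
    push_cast at h
    rw [← h]
    ring_nf
  have h1 : HasDerivAt (fun z => jacobiTheta₂ (z + (1 / 2 + τ / 2)) τ)
      (jacobiTheta₂' (1 / 2 + τ / 2) τ) 0 := by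
    have := hasDerivAt_jacobiTheta₂_fst (0 + (1 / 2 + τ / 2)) hτ
    simpa using this.comp_add_const 0 (1 / 2 + τ / 2)
  have h2 : HasDerivAt (fun z : ℂ => cexp (Real.pi * I * τ / 4 + Real.pi * I * (z + 1 / 2)))
      (cexp (Real.pi * I * τ / 4 + Real.pi * I * (0 + 1 / 2)) * (Real.pi * I * 1)) 0 := by
    exact ((((hasDerivAt_id (0 : ℂ)).add_const (1 / 2)).const_mul _).const_add _).cexp
  have h3 := h2.mul h1
  rw [zero_add (1 / 2 + τ / 2), h0, mul_zero, zero_add, Complex.exp_add,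
    show (Real.pi * I * (0 + 1 / 2) : ℂ) = Real.pi / 2 * I by ring,
    Complex.exp_pi_div_two_mul_I] at h3
  refine HasDerivAt.deriv (h3.congr_of_eventuallyEq (Eventually.of_forall fun z => ?_))
  simp only [Pi.mul_apply, theta_eq]
  push_cast
  ring_nf

lemma im_ofReal_mul_I_pos {T : ℝ} (hT : 0 < T) : 0 < ((T : ℂ) * I).im := by simpa using hT

lemma tendsto_theta_zero_left (b : ℚ) :
    Tendsto (fun T : ℝ => theta 0 b 0 (T * I)) atTop (𝓝 1) := by
  have hterm : ∀ (T : ℝ) (n : ℤ), cexp (2 * Real.pi * I * n * b)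
      * cexp (-(Real.pi * T * (n ^ 2 : ℤ)))
      = jacobiTheta₂_term n b (T * I) := by
    intro T n
    rw [jacobiTheta₂_term, ← Complex.exp_add]
    congr 1
    push_cast
    linear_combination (-(Real.pi : ℂ) * n ^ 2 * T) * Complex.I_sq
  have h := tendsto_tsum_mul_cexp (c := fun n => cexp (2 * Real.pi * I * n * b))
    (e := fun n => n ^ 2) (fun n => sq_nonneg n) (by
      have := (summable_jacobiTheta₂_term_iff b ((1 : ℝ) * I)).2 (by simp)
      refine this.congr fun n => ?_
      rw [← hterm]
      simp)
  simp only [hterm] at h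
  simp only [theta_zero_left, jacobiTheta₂]
  convert h using 2
  rw [tsum_eq_single 0]
  · simp
  · intro n hn
    simp [hn]

/-- The factor e^(πT/4) cancels the leading decay; the terms n = 0 and n = -1 then contribute 1
each. -/
lemma tendsto_theta_half_zero :
    Tendsto (fun T : ℝ => cexp (Real.pi * T / 4) * theta (1 / 2) 0 0 (T * I)) atTop (𝓝 2) := by
  have hterm : ∀ (T : ℝ) (n : ℤ), 1 * cexp (-(Real.pi * T * (n * (n + 1) : ℤ)))
      = jacobiTheta₂_term n (T * I / 2) (T * I) := by
    intro T n
    rw [jacobiTheta₂_term, one_mul]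
    congr 1
    push_cast
    linear_combination (-(Real.pi : ℂ) * n ^ 2 * T - Real.pi * n * T) * Complex.I_sq
  have h := tendsto_tsum_mul_cexp (c := fun _ => 1) (e := fun n => n * (n + 1))
    mul_succ_self_nonneg (by
      have := (summable_jacobiTheta₂_term_iff ((1 : ℝ) * I / 2) ((1 : ℝ) * I)).2 (by simp)
      refine this.congr fun n => ?_
      rw [← hterm]
      simp)
  simp only [hterm, tsum_ite_mul_succ_self_eq_zero] at h
  norm_num at h
  refine h.congr fun T => ?_
  rw [theta_half_zero_zero, ← mul_assoc, ← Complex.exp_add, ← jacobiTheta₂,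
    show (Real.pi * T / 4 + Real.pi * I * (T * I) / 4 : ℂ) = 0 by
      linear_combination (Real.pi * T / 4 : ℂ) * Complex.I_sq, Complex.exp_zero, one_mul]

/-- Here the surviving term n = 0 is killed by its factor n, so the limit comes from n = -1 alone.
-/
lemma tendsto_thetaDeriv :
    Tendsto (fun T : ℝ => cexp (Real.pi * T / 4) * thetaDeriv (T * I)) atTop
      (𝓝 (-2 * Real.pi)) := by
  have hterm : ∀ (T : ℝ) (n : ℤ), 2 * Real.pi * I * n * cexp (Real.pi * I * n) *
      cexp (-(Real.pi * T * (n * (n + 1) : ℤ)))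
      = jacobiTheta₂'_term n (1 / 2 + T * I / 2) (T * I) := by
    intro T n
    rw [jacobiTheta₂'_term, jacobiTheta₂_term, mul_assoc, ← Complex.exp_add]
    congr 2
    push_cast
    linear_combination (-(Real.pi : ℂ) * n ^ 2 * T - Real.pi * n * T) * Complex.I_sq
  have h := tendsto_tsum_mul_cexp (c := fun n => 2 * Real.pi * I * n * cexp (Real.pi * I * n))
    (e := fun n => n * (n + 1)) mul_succ_self_nonneg (by
      have := (summable_jacobiTheta₂'_term_iff (1 / 2 + (1 : ℝ) * I / 2) ((1 : ℝ) * I)).2 (by simp)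
      refine this.congr fun n => ?_
      rw [← hterm]
      simp)
  simp only [hterm, tsum_ite_mul_succ_self_eq_zero] at h
  have h := h.const_mul I
  have he : cexp (Real.pi * I * (-1 : ℤ)) = -1 := by
    rw [Int.cast_neg, Int.cast_one, mul_neg_one, Complex.exp_neg, Complex.exp_pi_mul_I]
    norm_num
  rw [he] at h
  have hlim : I * (2 * Real.pi * I * (0 : ℤ) * cexp (Real.pi * I * (0 : ℤ))
      + 2 * Real.pi * I * (-1 : ℤ) * -1) = -2 * Real.pi := by
    push_cast
    linear_combination (2 * Real.pi : ℂ) * Complex.I_sq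
  rw [hlim] at h
  refine h.congr' ?_
  filter_upwards [eventually_gt_atTop 0] with T hT
  rw [thetaDeriv_eq (im_ofReal_mul_I_pos hT), ← jacobiTheta₂', ← mul_assoc, ← mul_assoc,
    ← Complex.exp_add,
    show (Real.pi * T / 4 + Real.pi * I * (T * I) / 4 : ℂ) = 0 by
      linear_combination (Real.pi * T / 4 : ℂ) * Complex.I_sq, Complex.exp_zero, one_mul]

/-- The quotient of the two sides of Jacobi's derivative formula. -/
def jacobiQuotient (τ : ℂ) : ℂ :=
  thetaDeriv τ / (theta 0 0 0 τ * theta 0 (1 / 2) 0 τ * theta (1 / 2) 0 0 τ)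

lemma tendsto_jacobiQuotient :
    Tendsto (fun T : ℝ => jacobiQuotient (T * I)) atTop (𝓝 (-Real.pi)) := by
  have h := tendsto_thetaDeriv.div (((tendsto_theta_zero_left 0).mul
    (tendsto_theta_zero_left (1 / 2))).mul tendsto_theta_half_zero) (by norm_num)
  rw [show (-2 * Real.pi / (1 * 1 * 2) : ℂ) = -Real.pi by ring] at h
  refine h.congr fun T => ?_
  rw [jacobiQuotient]
  simp only [Pi.div_apply]
  rw [mul_left_comm (theta 0 0 0 _ * _), mul_div_mul_left _ _ (Complex.exp_ne_zero _)]

/-- The three even theta functions do not vanish at `0`. -/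
def ThetaNullNeZero (τ : ℂ) : Prop :=
  theta 0 0 0 τ ≠ 0 ∧ theta 0 (1 / 2) 0 τ ≠ 0 ∧ theta (1 / 2) 0 0 τ ≠ 0

/-- The duplication identities `e1`: θ₀₀θ₀₁(τ) = θ₀₁(2τ)² and `e2`: θ₁₀(τ)² = 2 θ₁₀θ₀₀(2τ) at 0
propagate nonvanishing. Together with the derivative at 0 of `theta_half_zero_mul_theta_half_half`
they show that the quotient is unchanged by τ ↦ 2τ. -/
lemma ThetaNullNeZero.two_mul {τ : ℂ} (hτ : 0 < τ.im) (h : ThetaNullNeZero τ) :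
    ThetaNullNeZero (2 * τ) ∧ jacobiQuotient (2 * τ) = jacobiQuotient τ := by
  have hτ2 : 0 < (2 * τ).im := by simpa using hτ
  obtain ⟨h00, h01, h10⟩ := h
  have e1 := theta_zero_zero_mul_theta_zero_half hτ 0
  have e2 := theta_addition_half_zero hτ 0 0
  simp only [mul_zero, add_zero, sub_zero] at e1 e2
  have n01 : theta 0 (1 / 2) 0 (2 * τ) ≠ 0 := by
    intro h
    rw [h, mul_zero] at e1
    exact mul_ne_zero h00 h01 e1
  have n00 : theta 0 0 0 (2 * τ) ≠ 0 := by
    intro h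
    rw [h, mul_zero, zero_mul, add_zero] at e2
    exact mul_ne_zero h10 h10 e2
  have n10 : theta (1 / 2) 0 0 (2 * τ) ≠ 0 := by
    intro h
    rw [h, mul_zero, zero_mul, add_zero] at e2
    exact mul_ne_zero h10 h10 e2
  refine ⟨⟨n00, n01, n10⟩, ?_⟩
  have d : theta (1 / 2) 0 0 τ * thetaDeriv τ
      = 2 * thetaDeriv (2 * τ) * theta 0 (1 / 2) 0 (2 * τ) := by
    have d1 := (differentiable_theta (1 / 2) 0 hτ 0).hasDerivAt.mul
      (hasDerivAt_theta_half_half_zero hτ)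
    have d3 : HasDerivAt (fun z : ℂ => theta (1 / 2) (1 / 2) z (2 * τ)) (thetaDeriv (2 * τ))
        (2 * 0) := by
      simpa using hasDerivAt_theta_half_half_zero hτ2
    have d2 := (d3.comp (0 : ℂ) ((hasDerivAt_id (0 : ℂ)).const_mul 2)).mul_const
      (theta 0 (1 / 2) 0 (2 * τ))
    rw [theta_half_half_zero, mul_zero, zero_add] at d1
    have := d1.unique (d2.congr_of_eventuallyEq (Eventually.of_forall fun x => by
      simpa using theta_half_zero_mul_theta_half_half hτ x))
    rw [this]
    ring
  rw [jacobiQuotient, jacobiQuotient, div_eq_div_iff (mul_ne_zero (mul_ne_zero n00 n01) n10)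
    (mul_ne_zero (mul_ne_zero h00 h01) h10)]
  apply mul_left_cancel₀ (mul_ne_zero n01 h10)
  linear_combination (-theta 0 0 0 (2 * τ) * theta 0 (1 / 2) 0 (2 * τ) ^ 2
      * theta (1 / 2) 0 0 (2 * τ)) * d
    + thetaDeriv (2 * τ) * theta 0 (1 / 2) 0 (2 * τ) * theta (1 / 2) 0 0 τ ^ 2 * e1
    + thetaDeriv (2 * τ) * theta 0 (1 / 2) 0 (2 * τ) ^ 3 * e2

lemma half_notMem_lattice {x y : ℝ} (h : (∀ m : ℤ, x ≠ m) ∨ ∀ m : ℤ, y ≠ m) :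
    (x + y * I : ℂ) ∉ lattice := by
  rw [mem_lattice]
  rintro ⟨m, n, hmn⟩
  rcases h with h | h
  · exact h m (by simpa using congrArg Complex.re hmn)
  · exact h n (by simpa using congrArg Complex.im hmn)

lemma half_ne_int (m : ℤ) : (-(1 / 2) : ℝ) ≠ m := by
  intro h
  have h2 : (-1 : ℝ) = (2 * m : ℤ) := by push_cast; linarith
  have h3 : (-1 : ℤ) = 2 * m := by exact_mod_cast h2
  omega

lemma thetaNullNeZero_I : ThetaNullNeZero I := by
  refine ⟨?_, ?_, ?_⟩ <;> rw [Ne, theta_eq_zero_iff]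
  · have := half_notMem_lattice (x := -(1 / 2)) (y := -(1 / 2)) (Or.inl half_ne_int)
    push_cast at this ⊢
    ring_nf at this ⊢
    exact this
  · have := half_notMem_lattice (x := 0) (y := -(1 / 2)) (Or.inr half_ne_int)
    push_cast at this ⊢
    ring_nf at this ⊢
    exact this
  · have := half_notMem_lattice (x := -(1 / 2)) (y := 0) (Or.inl half_ne_int)
    push_cast at this ⊢
    ring_nf at this ⊢
    exact this

/-- Jacobi's derivative formula at `τ = i`. -/
theorem thetaDeriv_I :
    thetaDeriv I = -Real.pi * (theta 0 0 0 I * theta 0 (1 / 2) 0 I * theta (1 / 2) 0 0 I) := by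
  -- The quotient is constant along 2ᵏ i, so its value at i is its limit at the cusp, -π.
  have hk : ∀ k : ℕ, ThetaNullNeZero (((2 ^ k : ℝ) : ℂ) * I) ∧
      jacobiQuotient (((2 ^ k : ℝ) : ℂ) * I) = jacobiQuotient I := by
    intro k
    induction k with
    | zero => simpa using thetaNullNeZero_I
    | succ k ih =>
      have := ih.1.two_mul (im_ofReal_mul_I_pos (by positivity))
      rw [show (((2 ^ (k + 1) : ℝ) : ℂ) * I) = 2 * (((2 ^ k : ℝ) : ℂ) * I) by push_cast; ring]
      exact ⟨this.1, this.2.trans ih.2⟩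
  have h := tendsto_jacobiQuotient.comp (tendsto_pow_atTop_atTop_of_one_lt (one_lt_two (α := ℝ)))
  have h2 : jacobiQuotient I = -Real.pi := by
    refine tendsto_nhds_unique (tendsto_const_nhds.congr fun k => ?_) h
    exact ((hk k).2).symm
  obtain ⟨h00, h01, h10⟩ := thetaNullNeZero_I
  rw [jacobiQuotient, div_eq_iff (mul_ne_zero (mul_ne_zero h00 h01) h10)] at h2
  exact h2

/-- Jacobi's transformation τ ↦ -1/τ exchanges these two theta functions and fixes i. -/
lemma theta_zero_half_eq_theta_half_zero : theta 0 (1 / 2) 0 I = theta (1 / 2) 0 0 I := by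
  rw [theta_zero_left, theta_half_zero_zero, jacobiTheta₂_functional_equation,
    ← jacobiTheta₂_neg_left (I / 2)]
  have h1 : (-I * I : ℂ) = 1 := by linear_combination -Complex.I_sq
  have h2 : (-1 / I : ℂ) = I := by rw [div_eq_iff I_ne_zero, I_mul_I]
  have h3 : (((1 / 2 : ℚ) : ℂ) / I) = -(I / 2) := by
    rw [div_eq_iff I_ne_zero]
    push_cast
    linear_combination (1 / 2 : ℂ) * Complex.I_sq
  have h4 : (-Real.pi * I * ((1 / 2 : ℚ) : ℂ) ^ 2 / I : ℂ) = Real.pi * I * I / 4 := by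
    rw [div_eq_iff I_ne_zero]
    push_cast
    linear_combination (-(Real.pi : ℂ) * I / 4) * Complex.I_sq
  rw [h1, h2, h3, h4, Complex.one_cpow, div_one, one_mul]

/-! ### The square lattice: relations between the theta functions at `τ = i` -/

/-- `ϑ₀₀(z, i)`. -/
def th00 (z : ℂ) : ℂ := theta 0 0 z I

/-- `ϑ_{0,1/2}(z, i)`. -/
def th01 (z : ℂ) : ℂ := theta 0 (1 / 2) z I

/-- `ϑ_{1/2,0}(z, i)`. -/
def th10 (z : ℂ) : ℂ := theta (1 / 2) 0 z I

/-- `ϑ_{1/2,1/2}(z, i)`. -/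
def th11 (z : ℂ) : ℂ := theta (1 / 2) (1 / 2) z I

/-- `ϑ₀₀(2z, 2i)`. -/
def thX (z : ℂ) : ℂ := theta 0 0 (2 * z) (2 * I)

/-- `ϑ_{1/2,0}(2z, 2i)`. -/
def thY (z : ℂ) : ℂ := theta (1 / 2) 0 (2 * z) (2 * I)

lemma zero_lt_I_im : 0 < I.im := by simp

lemma differentiable_th00 : Differentiable ℂ th00 := differentiable_theta _ _ zero_lt_I_im
lemma differentiable_th01 : Differentiable ℂ th01 := differentiable_theta _ _ zero_lt_I_im
lemma differentiable_th10 : Differentiable ℂ th10 := differentiable_theta _ _ zero_lt_I_im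
lemma differentiable_th11 : Differentiable ℂ th11 := differentiable_theta _ _ zero_lt_I_im

lemma differentiable_thX : Differentiable ℂ thX :=
  (differentiable_theta 0 0 (τ := 2 * I) (by simp)).comp (differentiable_id.const_mul 2)

lemma differentiable_thY : Differentiable ℂ thY :=
  (differentiable_theta (1 / 2) 0 (τ := 2 * I) (by simp)).comp (differentiable_id.const_mul 2)

lemma th00_add_mul_sub (x y : ℂ) :
    th00 (x + y) * th00 (x - y) = thX x * thX y + thY x * thY y :=
  theta_addition_zero_zero zero_lt_I_im x y

lemma th01_add_mul_sub (x y : ℂ) :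
    th01 (x + y) * th01 (x - y) = thX x * thX y - thY x * thY y :=
  theta_addition_zero_half zero_lt_I_im x y

lemma th10_add_mul_sub (x y : ℂ) :
    th10 (x + y) * th10 (x - y) = thY x * thX y + thX x * thY y :=
  theta_addition_half_zero zero_lt_I_im x y

lemma th11_add_mul_sub (x y : ℂ) :
    th11 (x + y) * th11 (x - y) = thX x * thY y - thY x * thX y :=
  theta_addition_half_half zero_lt_I_im x y

lemma th00_sq (z : ℂ) : th00 z ^ 2 = thX z * thX 0 + thY z * thY 0 := by
  simpa [sq] using th00_add_mul_sub z 0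

lemma th01_sq (z : ℂ) : th01 z ^ 2 = thX z * thX 0 - thY z * thY 0 := by
  simpa [sq] using th01_add_mul_sub z 0

lemma th10_sq (z : ℂ) : th10 z ^ 2 = thY z * thX 0 + thX z * thY 0 := by
  simpa [sq] using th10_add_mul_sub z 0

lemma th11_sq (z : ℂ) : th11 z ^ 2 = thX z * thY 0 - thY z * thX 0 := by
  simpa [sq] using th11_add_mul_sub z 0

lemma th01_two_mul (z : ℂ) : th01 (2 * z) * th01 0 = thX z ^ 2 - thY z ^ 2 := by
  simpa [sq, two_mul] using th01_add_mul_sub z z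

lemma th10_two_mul (z : ℂ) : th10 (2 * z) * th10 0 = 2 * thX z * thY z := by
  have h := th10_add_mul_sub z z
  rw [sub_self, ← two_mul] at h
  rw [h]
  ring

lemma th00_zero_ne : th00 0 ≠ 0 := thetaNullNeZero_I.1
lemma th01_zero_ne : th01 0 ≠ 0 := thetaNullNeZero_I.2.1
lemma th10_zero_ne : th10 0 ≠ 0 := thetaNullNeZero_I.2.2
lemma th11_zero : th11 0 = 0 := theta_half_half_zero I

lemma th00_neg (z : ℂ) : th00 (-z) = th00 z := theta_zero_zero_neg z I
lemma th01_neg (z : ℂ) : th01 (-z) = th01 z := theta_zero_half_neg z I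
lemma th10_neg (z : ℂ) : th10 (-z) = th10 z := theta_half_zero_neg z I
lemma th11_neg (z : ℂ) : th11 (-z) = -th11 z := theta_half_half_neg z I

lemma th11_eq_zero_iff (z : ℂ) : th11 z = 0 ↔ z ∈ lattice := theta_half_half_eq_zero_iff z

/-- The relation between the theta constants which expresses the symmetry of the square lattice. -/
lemma thX_zero_sq_sub : thX 0 ^ 2 - thY 0 ^ 2 = 2 * thX 0 * thY 0 := by
  have h1 := th01_sq 0
  have h2 := th10_sq 0
  have h3 : th01 0 = th10 0 := theta_zero_half_eq_theta_half_zero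
  rw [h3] at h1
  linear_combination h2 - h1

lemma th_quartic (z : ℂ) : 2 * (th01 z ^ 2 * th10 z ^ 2) = th00 z ^ 4 - th11 z ^ 4 := by
  rw [show th00 z ^ 4 = (th00 z ^ 2) ^ 2 by ring, show th11 z ^ 4 = (th11 z ^ 2) ^ 2 by ring,
    th00_sq, th01_sq, th10_sq, th11_sq]
  linear_combination (-(thX z ^ 2 - thY z ^ 2) + 2 * thX z * thY z) * thX_zero_sq_sub

/-- By the addition formulas, with the theta constants of `thX_zero_sq_sub`, both sides are
multiples of (X² - Y²)² - (2XY)². Only squares are accessible in this way; the sign is settled in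
`th11_two_mul`. -/
lemma th11_two_mul_sq (z : ℂ) :
    (th00 0 * th01 0 * th10 0 * th11 (2 * z)) ^ 2
      = (2 * (th00 z * th01 z * th10 z * th11 z)) ^ 2 := by
  have hr := thX_zero_sq_sub
  have e0 := th00_sq 0
  have e1 := th01_sq 0
  have e2 := th10_sq 0
  have f1 := th01_sq (2 * z)
  have f2 := th10_sq (2 * z)
  have f3 := th11_sq (2 * z)
  have g1 := th01_two_mul z
  have g2 := th10_two_mul z
  have k0 := th00_sq z
  have k1 := th01_sq z
  have k2 := th10_sq z
  have k3 := th11_sq z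
  set A := thX 0
  set B := thY 0
  set X := thX z
  set Y := thY z
  have h1 : th00 0 ^ 2 * th11 (2 * z) ^ 2 = (X ^ 2 - Y ^ 2) ^ 2 - (2 * X * Y) ^ 2 := by
    rw [← g1, ← g2, mul_pow, mul_pow, e0, e1, e2, f1, f2, f3]
    linear_combination (-(A + B) * thX (2 * z) - (A - B) * thY (2 * z)) * hr
  have h2 : (th00 z * th01 z * th10 z * th11 z) ^ 2
      = A ^ 2 * B ^ 2 * ((X ^ 2 - Y ^ 2) ^ 2 - (2 * X * Y) ^ 2) := by
    rw [mul_pow, mul_pow, mul_pow, k0, k1, k2, k3]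
    linear_combination (-X ^ 2 * Y ^ 2 * (A ^ 2 - B ^ 2 + 2 * A * B)) * hr
  have h3 : th01 0 ^ 2 * th10 0 ^ 2 = 4 * A ^ 2 * B ^ 2 := by
    rw [e1, e2]
    linear_combination (2 * A * B) * hr
  calc _ = th01 0 ^ 2 * th10 0 ^ 2 * (th00 0 ^ 2 * th11 (2 * z) ^ 2) := by ring
    _ = 4 * (A ^ 2 * B ^ 2 * ((X ^ 2 - Y ^ 2) ^ 2 - (2 * X * Y) ^ 2)) := by rw [h1, h3]; ring
    _ = _ := by rw [← h2]; ring

lemma hasDerivAt_th11_zero : HasDerivAt th11 (thetaDeriv I) 0 :=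
  hasDerivAt_theta_half_half_zero zero_lt_I_im

lemma thetaDeriv_I_eq : thetaDeriv I = -Real.pi * (th00 0 * th01 0 * th10 0) := thetaDeriv_I

lemma thetaDeriv_I_ne : thetaDeriv I ≠ 0 := by
  rw [thetaDeriv_I_eq]
  exact mul_ne_zero (neg_ne_zero.2 (by exact_mod_cast Real.pi_ne_zero))
    (mul_ne_zero (mul_ne_zero th00_zero_ne th01_zero_ne) th10_zero_ne)

/-- The duplication formula for the odd theta function. -/
theorem th11_two_mul (z : ℂ) :
    th00 0 * th01 0 * th10 0 * th11 (2 * z) = 2 * (th00 z * th01 z * th10 z * th11 z) := by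
  set f : ℂ → ℂ := fun z => th00 0 * th01 0 * th10 0 * th11 (2 * z) with hf
  set g : ℂ → ℂ := fun z => 2 * (th00 z * th01 z * th10 z * th11 z) with hg
  have h00 := differentiable_th00
  have h01 := differentiable_th01
  have h10 := differentiable_th10
  have h11 := differentiable_th11
  have df : Differentiable ℂ f := by fun_prop
  have dg : Differentiable ℂ g := by fun_prop
  have c0 : th00 0 * th01 0 * th10 0 ≠ 0 :=
    mul_ne_zero (mul_ne_zero th00_zero_ne th01_zero_ne) th10_zero_ne
  -- From f² = g², the product (f - g)(f + g) vanishes identically, so one of the two entire factors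
  -- does.
  have h := AnalyticOnNhd.eq_zero_or_eq_zero_of_smul_eq_zero (𝕜 := ℂ) (f := f - g) (g := f + g)
    (U := Set.univ) ((df.sub dg).differentiableOn.analyticOnNhd isOpen_univ)
    ((df.add dg).differentiableOn.analyticOnNhd isOpen_univ)
    (fun z _ => by
      have := th11_two_mul_sq z
      simp only [Pi.sub_apply, Pi.add_apply, smul_eq_mul, hf, hg]
      linear_combination this) isPreconnected_univ
  rcases h with h | h
  · exact sub_eq_zero.1 (h z trivial)
  -- If f = -g, the derivatives at 0 would add up to zero, but both equal the same nonzero number.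
  · exfalso
    have d1 : HasDerivAt f (th00 0 * th01 0 * th10 0 * (thetaDeriv I * (2 * 1))) 0 := by
      have d3 : HasDerivAt th11 (thetaDeriv I) (2 * 0) := by simpa using hasDerivAt_th11_zero
      exact (d3.comp (0 : ℂ) ((hasDerivAt_id (0 : ℂ)).const_mul 2)).const_mul _
    have d2 : HasDerivAt g (2 * (th00 0 * th01 0 * th10 0 * thetaDeriv I)) 0 := by
      have := ((((h00.mul h01).mul h10) 0).hasDerivAt.mul hasDerivAt_th11_zero).const_mul 2
      rw [th11_zero, mul_zero, zero_add] at this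
      exact this
    have d0 : f + g = fun _ => 0 := funext fun z => h z trivial
    have := (d1.add d2).unique (d0 ▸ hasDerivAt_const (0 : ℂ) (0 : ℂ))
    have h4 : 4 * (th00 0 * th01 0 * th10 0 * thetaDeriv I) = 0 := by linear_combination this
    exact mul_ne_zero (by norm_num) (mul_ne_zero c0 thetaDeriv_I_ne) h4

/-- This is the derivative in y, at y = z, of the addition formula for θ₁₁(z + y) θ₁₁(z - y); only
the derivative of the vanishing factor contributes. -/
lemma thX_mul_deriv_thY_sub (z : ℂ) :
    thX z * deriv thY z - thY z * deriv thX z = -thetaDeriv I * th11 (2 * z) := by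
  have d0 : HasDerivAt th11 (thetaDeriv I) (z - z) := by
    simpa using hasDerivAt_th11_zero
  have d1 : HasDerivAt (fun y => th11 (z + y)) (deriv th11 (z + z)) z :=
    ((differentiable_th11 _).hasDerivAt).comp_const_add z z
  have d2 : HasDerivAt (fun y => th11 (z - y)) (-thetaDeriv I) z := d0.comp_const_sub z z
  have d3 := d1.mul d2
  have d4 := ((differentiable_thY z).hasDerivAt.const_mul (thX z)).sub
    ((differentiable_thX z).hasDerivAt.const_mul (thY z))
  have := d4.unique (d3.congr_of_eventuallyEq
    (Eventually.of_forall fun y => (th11_add_mul_sub z y).symm))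
  rw [sub_self, th11_zero, mul_zero, zero_add] at this
  rw [this, two_mul]
  ring

/-! ### The coordinates of the curve as elliptic functions -/

/-- The constant `2 (1 - i) π ϑ₀₀(0, i)²`. -/
def period : ℂ := 2 * (1 - I) * Real.pi * th00 0 ^ 2

/-- The coordinate `w = u² / t` as a function on `ℂ`. -/
def wFun (z : ℂ) : ℂ := -I * th11 z ^ 2 / th00 z ^ 2

/-- The coordinate `t` as a function on `ℂ`. -/
def tFun (z : ℂ) : ℂ := 2 * (th01 z ^ 2 * th10 z ^ 2) / th00 z ^ 4

/-- The coordinate `u` as a function on `ℂ`. -/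
def uFun (z : ℂ) : ℂ := -(1 - I) * (th01 z * th10 z * th11 z) / th00 z ^ 3

lemma one_sub_I_ne : (1 - I : ℂ) ≠ 0 := by
  intro h
  simpa using congrArg Complex.re h

lemma period_ne_zero : period ≠ 0 :=
  mul_ne_zero (mul_ne_zero (mul_ne_zero two_ne_zero one_sub_I_ne)
    (by exact_mod_cast Real.pi_ne_zero)) (pow_ne_zero 2 th00_zero_ne)

lemma one_sub_I_sq : (1 - I : ℂ) ^ 2 = -2 * I := by
  linear_combination Complex.I_sq

lemma tFun_eq {z : ℂ} (hz : th00 z ≠ 0) : tFun z = 1 - th11 z ^ 4 / th00 z ^ 4 := by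
  rw [tFun, th_quartic]
  field_simp

lemma wFun_sq {z : ℂ} (hz : th00 z ≠ 0) : wFun z ^ 2 = tFun z - 1 := by
  rw [tFun_eq hz, wFun, div_pow, mul_pow, neg_sq, Complex.I_sq]
  ring

lemma uFun_sq {z : ℂ} (hz : th00 z ≠ 0) : uFun z ^ 2 = tFun z * wFun z := by
  rw [uFun, wFun, tFun, div_pow, mul_pow, neg_sq, one_sub_I_sq]
  field_simp

/-- As a function of `thY / thX`, w is a Möbius transformation, so its derivative is a constant
times the Wronskian of `thX` and `thY` over θ₀₀⁴. The duplication and Jacobi formulas turn the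
Wronskian into 2π times the product of the four theta functions, and one θ₀₀ cancels. -/
lemma hasDerivAt_wFun {z : ℂ} (hz : th00 z ≠ 0) :
    HasDerivAt wFun (period / 2 * uFun z) z := by
  have hw : wFun = fun z =>
      -I * ((thX z * thY 0 - thY z * thX 0) / (thX z * thX 0 + thY z * thY 0)) := by
    funext z
    rw [wFun, th11_sq, th00_sq, mul_div_assoc]
  have hne : thX z * thX 0 + thY z * thY 0 ≠ 0 := by
    rw [← th00_sq]
    exact pow_ne_zero 2 hz
  have dX := (differentiable_thX z).hasDerivAt
  have dY := (differentiable_thY z).hasDerivAt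
  have d := ((((dX.mul_const (thY 0)).sub (dY.mul_const (thX 0))).div
    ((dX.mul_const (thX 0)).add (dY.mul_const (thY 0))) hne).const_mul (-I))
  rw [hw]
  refine d.congr_deriv ?_
  simp only [Pi.sub_apply, Pi.add_apply]
  rw [← th00_sq, ← th11_sq, period, uFun]
  have hwr := thX_mul_deriv_thY_sub z
  have h0 := th00_sq 0
  have hd := th11_two_mul z
  rw [thetaDeriv_I_eq] at hwr
  have hwr' : thX z * deriv thY z - thY z * deriv thX z
      = 2 * Real.pi * (th00 z * th01 z * th10 z * th11 z) := by
    rw [hwr]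
    linear_combination (Real.pi : ℂ) * hd
  have hnum : (deriv thX z * thY 0 - deriv thY z * thX 0) * th00 z ^ 2
      - th11 z ^ 2 * (deriv thX z * thX 0 + deriv thY z * thY 0)
      = -(th00 0 ^ 2 * (2 * Real.pi * (th00 z * th01 z * th10 z * th11 z))) := by
    rw [← hwr', h0, th00_sq, th11_sq]
    ring
  rw [hnum]
  field_simp
  linear_combination (th01 z * th10 z * th11 z * th00 0 ^ 2) * Complex.I_sq

lemma isOpen_th00_ne : IsOpen {z : ℂ | th00 z ≠ 0} :=
  differentiable_th00.continuous.isOpen_preimage _ isOpen_ne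

lemma hasDerivAt_tFun {z : ℂ} (hz : th00 z ≠ 0) :
    HasDerivAt tFun (period * wFun z * uFun z) z := by
  have h : tFun =ᶠ[𝓝 z] fun z => wFun z ^ 2 + 1 := by
    filter_upwards [isOpen_th00_ne.mem_nhds hz] with y hy
    rw [wFun_sq hy]
    ring
  have d := ((hasDerivAt_wFun hz).pow 2).add_const 1
  refine (d.congr_of_eventuallyEq h).congr_deriv ?_
  simp only [Nat.cast_ofNat, Nat.add_one_sub_one, pow_one]
  ring

/-! ### The period as a beta integral -/

lemma conj_theta (a b : ℚ) (z τ : ℂ) :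
    (starRingEnd ℂ) (theta a b z τ)
      = theta (-a) b ((starRingEnd ℂ) z) (-(starRingEnd ℂ) τ) := by
  rw [theta_eq_tsum, theta_eq_tsum, Complex.conj_tsum, ← (Equiv.neg ℤ).tsum_eq]
  refine tsum_congr fun n => ?_
  simp only [thetaTerm, Equiv.neg_apply, ← Complex.exp_conj]
  congr 1
  simp only [map_add, map_mul, map_pow, Complex.conj_ofReal, Complex.conj_I, map_ofNat,
    map_intCast, map_ratCast]
  push_cast
  ring

/-- Since -conj(i) = i, conjugation only changes the sign of a, which is harmless modulo 1 for a = 0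
and a = 1/2. Hence the theta functions are real on the real axis. -/
lemma conj_theta_ofReal (a b : ℚ) (x : ℝ) :
    (starRingEnd ℂ) (theta a b x I) = theta (-a) b x I := by
  rw [conj_theta]
  simp

lemma exists_theta_zero_ofReal (b : ℚ) (x : ℝ) : ∃ r : ℝ, theta 0 b x I = r := by
  obtain ⟨r, hr⟩ := Complex.conj_eq_iff_real.1
    ((conj_theta_ofReal 0 b x).trans (by rw [neg_zero]))
  exact ⟨r, hr⟩

lemma exists_theta_half_ofReal (b : ℚ) (x : ℝ) : ∃ r : ℝ, theta (1 / 2) b x I = r := by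
  obtain ⟨r, hr⟩ := Complex.conj_eq_iff_real.1
    ((conj_theta_ofReal (1 / 2) b x).trans (by
      rw [← theta_char_add_one]
      norm_num))
  exact ⟨r, hr⟩

lemma th00_ofReal_ne_zero (x : ℝ) : th00 x ≠ 0 := by
  rw [th00, Ne, theta_eq_zero_iff]
  have := half_notMem_lattice (x := x - 1 / 2) (y := -(1 / 2)) (Or.inr half_ne_int)
  push_cast at this ⊢
  ring_nf at this ⊢
  exact this

lemma th01_ofReal_ne_zero (x : ℝ) : th01 x ≠ 0 := by
  rw [th01, Ne, theta_eq_zero_iff]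
  have := half_notMem_lattice (x := x) (y := -(1 / 2)) (Or.inr half_ne_int)
  push_cast at this ⊢
  ring_nf at this ⊢
  exact this

lemma ne_int_of_mem_Ioo {x : ℝ} {k : ℤ} (h1 : (k : ℝ) < x) (h2 : x < k + 1) (m : ℤ) :
    x ≠ m := by
  rintro rfl
  have h3 : k < m := by exact_mod_cast h1
  have h4 : m < k + 1 := by exact_mod_cast h2
  omega

lemma th10_ofReal_ne_zero {x : ℝ} (hx : x ∈ Set.Ioo (0 : ℝ) (1 / 2)) : th10 x ≠ 0 := by
  rw [th10, Ne, theta_eq_zero_iff]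
  have := half_notMem_lattice (x := x - 1 / 2) (y := 0)
    (Or.inl (ne_int_of_mem_Ioo (k := -1) (by push_cast; linarith [hx.1])
      (by push_cast; linarith [hx.2])))
  push_cast at this ⊢
  ring_nf at this ⊢
  exact this

lemma th11_ofReal_ne_zero {x : ℝ} (hx : x ∈ Set.Ioo (0 : ℝ) (1 / 2)) : th11 x ≠ 0 := by
  rw [Ne, th11_eq_zero_iff]
  have := half_notMem_lattice (x := x) (y := 0)
    (Or.inl (ne_int_of_mem_Ioo (k := 0) (by push_cast; linarith [hx.1])
      (by push_cast; linarith [hx.2])))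
  simpa using this

lemma th10_half : th10 (1 / 2) = 0 := by
  rw [th10, theta_eq_zero_iff]
  convert zero_mem lattice using 1
  push_cast
  ring

/-- The real function `ϑ₁₁(x, i)² / ϑ₀₀(x, i)²`. -/
def vFun (x : ℝ) : ℝ := (I * wFun x).re

lemma ofReal_vFun (x : ℝ) : (vFun x : ℂ) = I * wFun x ∧ 0 ≤ vFun x ∧
    (th11 x ≠ 0 → 0 < vFun x) ∧
    ((1 - vFun x ^ 2 : ℝ) : ℂ) = tFun x ∧ 0 ≤ 1 - vFun x ^ 2 ∧
    (th10 x ≠ 0 → 0 < 1 - vFun x ^ 2) := by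
  obtain ⟨a, ha⟩ : ∃ r : ℝ, th00 x = r := exists_theta_zero_ofReal 0 x
  obtain ⟨b, hb⟩ : ∃ r : ℝ, th01 x = r := exists_theta_zero_ofReal (1 / 2) x
  obtain ⟨c, hc⟩ : ∃ r : ℝ, th10 x = r := exists_theta_half_ofReal 0 x
  obtain ⟨d, hd⟩ : ∃ r : ℝ, th11 x = r := exists_theta_half_ofReal (1 / 2) x
  have ha0 : a ≠ 0 := by
    have := th00_ofReal_ne_zero x
    rw [ha] at this
    exact_mod_cast this
  have hb0 : b ≠ 0 := by
    have := th01_ofReal_ne_zero x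
    rw [hb] at this
    exact_mod_cast this
  have hw : I * wFun x = ((d ^ 2 / a ^ 2 : ℝ) : ℂ) := by
    rw [wFun, ha, hd]
    push_cast
    linear_combination (-(d : ℂ) ^ 2 / a ^ 2) * Complex.I_sq
  have hv : vFun x = d ^ 2 / a ^ 2 := by rw [vFun, hw, Complex.ofReal_re]
  have ht : ((1 - vFun x ^ 2 : ℝ) : ℂ) = tFun x := by
    have h1 := wFun_sq (th00_ofReal_ne_zero x)
    have h2 : (vFun x : ℂ) = I * wFun x := by rw [hv, hw]
    rw [Complex.ofReal_sub, Complex.ofReal_pow, h2, mul_pow, Complex.I_sq, h1]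
    push_cast
    ring
  have ht' : 1 - vFun x ^ 2 = 2 * (b ^ 2 * c ^ 2) / a ^ 4 := by
    rw [tFun, ha, hb, hc] at ht
    exact_mod_cast ht
  refine ⟨by rw [hv, hw], by rw [hv]; positivity, fun h => ?_, ht, by rw [ht']; positivity,
    fun h => ?_⟩
  · have hd0 : d ≠ 0 := by
      rw [hd] at h
      exact_mod_cast h
    rw [hv]
    positivity
  · have hc0 : c ≠ 0 := by
      rw [hc] at h
      exact_mod_cast h
    rw [ht']
    positivity

lemma vFun_zero : vFun 0 = 0 := by
  simp [vFun, wFun, th11_zero]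

lemma vFun_half : vFun (1 / 2) = 1 := by
  obtain ⟨-, h0, -, ht, -⟩ := ofReal_vFun (1 / 2)
  have : tFun ((1 / 2 : ℝ) : ℂ) = 0 := by
    rw [tFun, show ((1 / 2 : ℝ) : ℂ) = 1 / 2 by push_cast; rfl, th10_half]
    ring
  rw [this] at ht
  have h2 : 1 - vFun (1 / 2) ^ 2 = 0 := by exact_mod_cast ht
  nlinarith

/-- Squaring v' = i (period/2) u and using u² = t w eliminates u. The sign of v' is determined
later, and only on (0, 1/2). -/
lemma exists_hasDerivAt_vFun (x : ℝ) : ∃ d : ℝ, HasDerivAt vFun d x ∧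
    d ^ 2 = 2 * (Real.pi * (th00 0).re ^ 2) ^ 2 * (vFun x * (1 - vFun x ^ 2)) := by
  have hne := th00_ofReal_ne_zero x
  have hd := ((hasDerivAt_wFun hne).const_mul I).real_of_complex
  refine ⟨_, hd, ?_⟩
  obtain ⟨hv, -, -, ht, -⟩ := ofReal_vFun x
  obtain ⟨a, ha⟩ : ∃ r : ℝ, th00 x = r := exists_theta_zero_ofReal 0 x
  obtain ⟨b, hb⟩ : ∃ r : ℝ, th01 x = r := exists_theta_zero_ofReal (1 / 2) x
  obtain ⟨c, hc⟩ : ∃ r : ℝ, th10 x = r := exists_theta_half_ofReal 0 x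
  obtain ⟨d, hd⟩ : ∃ r : ℝ, th11 x = r := exists_theta_half_ofReal (1 / 2) x
  obtain ⟨e, he⟩ : ∃ r : ℝ, th00 0 = r := by
    have := exists_theta_zero_ofReal 0 0
    rwa [Complex.ofReal_zero] at this
  have hreal : I * (period / 2 * uFun x)
      = ((-2 * (Real.pi * e ^ 2) * (b * c * d / a ^ 3) : ℝ) : ℂ) := by
    rw [period, uFun, ha, hb, hc, hd, he]
    push_cast
    linear_combination (-I * Real.pi * e ^ 2 * (b * c * d / a ^ 3)) * one_sub_I_sq
      + (2 * Real.pi * e ^ 2 * (b * c * d / a ^ 3)) * Complex.I_sq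
  have hsq : (I * (period / 2 * uFun x)) ^ 2
      = 2 * (Real.pi * e ^ 2) ^ 2 * (vFun x * (1 - vFun x ^ 2 : ℝ)) := by
    rw [ht, hv, mul_pow, mul_pow, uFun_sq hne, Complex.I_sq, period, he]
    linear_combination (-(Real.pi * e ^ 2 : ℂ) ^ 2 * (tFun x * wFun x)) * one_sub_I_sq
  rw [hreal] at hsq ⊢
  rw [Complex.ofReal_re, he, Complex.ofReal_re]
  exact_mod_cast hsq

lemma th00_zero_re_ne : (th00 0).re ≠ 0 := by
  obtain ⟨e, he⟩ := exists_theta_zero_ofReal 0 0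
  rw [Complex.ofReal_zero] at he
  change th00 0 = e at he
  have := th00_zero_ne
  rw [he] at this ⊢
  rw [Complex.ofReal_re]
  exact_mod_cast this

lemma ofReal_th00_zero_re : ((th00 0).re : ℂ) = th00 0 := by
  obtain ⟨e, he⟩ := exists_theta_zero_ofReal 0 0
  rw [Complex.ofReal_zero] at he
  change th00 0 = e at he
  rw [he, Complex.ofReal_re]

lemma continuous_vFun : Continuous vFun :=
  continuous_iff_continuousAt.2 fun x => (exists_hasDerivAt_vFun x).choose_spec.1.continuousAt

/-- The derivative does not vanish on (0, 1/2), so it has constant sign there by Darboux; the sign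
is positive because v goes from 0 to 1. -/
lemma hasDerivAt_vFun {x : ℝ} (hx : x ∈ Set.Ioo (0 : ℝ) (1 / 2)) :
    HasDerivAt vFun (√2 * (Real.pi * (th00 0).re ^ 2)
      * (vFun x ^ (1 / 2 : ℝ) * (1 - vFun x ^ 2) ^ (1 / 2 : ℝ))) x := by
  choose d hd hsq using exists_hasDerivAt_vFun
  have hq : 0 < Real.pi * (th00 0).re ^ 2 :=
    mul_pos Real.pi_pos (by have := th00_zero_re_ne; positivity)
  have hpos : ∀ y ∈ Set.Ioo (0 : ℝ) (1 / 2), 0 < vFun y ∧ 0 < 1 - vFun y ^ 2 := fun y hy =>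
    ⟨(ofReal_vFun y).2.2.1 (th11_ofReal_ne_zero hy),
      (ofReal_vFun y).2.2.2.2.2 (th10_ofReal_ne_zero hy)⟩
  have hne : ∀ y ∈ Set.Ioo (0 : ℝ) (1 / 2), d y ≠ 0 := by
    intro y hy h0
    have h := hsq y
    obtain ⟨h1, h2⟩ := hpos y hy
    rw [h0] at h
    have : 0 < 2 * (Real.pi * (th00 0).re ^ 2) ^ 2 * (vFun y * (1 - vFun y ^ 2)) := by positivity
    rw [← h] at this
    norm_num at this
  have hdpos : 0 < d x := by
    rcases hasDerivWithinAt_forall_lt_or_forall_gt_of_forall_ne (convex_Ioo 0 (1 / 2))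
      (fun y _ => (hd y).hasDerivWithinAt) hne with h | h
    · exfalso
      have hanti : StrictAntiOn vFun (Set.Icc 0 (1 / 2)) :=
        strictAntiOn_of_deriv_neg (convex_Icc _ _) continuous_vFun.continuousOn (by
          rw [interior_Icc]
          intro y hy
          rw [(hd y).deriv]
          exact h y hy)
      have := hanti (Set.left_mem_Icc.2 (by norm_num)) (Set.right_mem_Icc.2 (by norm_num))
        (by norm_num)
      rw [vFun_zero, vFun_half] at this
      norm_num at this
    · exact h x hx
  refine (hd x).congr_deriv ?_
  obtain ⟨h1, h2⟩ := hpos x hx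
  rw [← pow_left_inj₀ hdpos.le (by positivity) two_ne_zero, hsq, ← Real.sqrt_eq_rpow,
    ← Real.sqrt_eq_rpow, mul_pow (√2 * _), mul_pow √(vFun x), mul_pow √2, Real.sq_sqrt h1.le,
    Real.sq_sqrt h2.le, Real.sq_sqrt two_pos.le]

/-! ### Evaluation of the beta integrals -/

/-- The integrand of the beta integral. -/
def betaIntegrand (u v : ℂ) (x : ℝ) : ℂ := (x : ℂ) ^ (u - 1) * (1 - (x : ℂ)) ^ (v - 1)

lemma continuousAt_betaIntegrand (u v : ℂ) {x : ℝ} (hx : x ∈ Set.Ioo (0 : ℝ) 1) :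
    ContinuousAt (betaIntegrand u v) x := by
  refine ContinuousAt.mul ?_ ?_
  · exact (Complex.continuous_ofReal.continuousAt).cpow continuousAt_const
      (Or.inl (by simpa using hx.1))
  · exact (continuousAt_const.sub Complex.continuous_ofReal.continuousAt).cpow continuousAt_const
      (Or.inl (by simpa using hx.2))

lemma hasDerivAt_integral_betaIntegrand {u v : ℂ} (hu : 0 < u.re) (hv : 0 < v.re) {x : ℝ}
    (hx : x ∈ Set.Ioo (0 : ℝ) 1) :
    HasDerivAt (fun s : ℝ => ∫ r in (0 : ℝ)..s, betaIntegrand u v r) (betaIntegrand u v x) x := by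
  have hc := continuousAt_betaIntegrand u v hx
  refine intervalIntegral.integral_hasDerivAt_right ?_ ?_ hc
  · refine (Complex.betaIntegral_convergent hu hv).mono_set ?_
    rw [Set.uIcc_of_le hx.1.le, Set.uIcc_of_le zero_le_one]
    exact Set.Icc_subset_Icc_right hx.2.le
  · exact ContinuousOn.stronglyMeasurableAtFilter isOpen_Ioo
      (fun y hy => (continuousAt_betaIntegrand u v hy).continuousWithinAt) x hx

/-- Substitute x = v(s)² with 0 ≤ s ≤ 1/2: the differential equation of v makes the integrand the
constant 2k. The beta integrand is singular at the ends, so the primitive `G` is differentiated only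
inside and is merely continuous on the closed interval. -/
lemma betaIntegral_quarter_half :
    Complex.betaIntegral (1 / 4) (1 / 2) = √2 * (Real.pi * (th00 0).re ^ 2) := by
  set k := √2 * (Real.pi * (th00 0).re ^ 2) with hk
  set G : ℝ → ℂ := fun s => ∫ r in (0 : ℝ)..s, betaIntegrand (1 / 4) (1 / 2) r with hG
  have hu : 0 < (1 / 4 : ℂ).re := by norm_num
  have hv : 0 < (1 / 2 : ℂ).re := by norm_num
  have hGc : ContinuousOn G (Set.Icc 0 1) := by
    have := intervalIntegral.continuousOn_primitive_interval'
      (Complex.betaIntegral_convergent hu hv) (Set.left_mem_uIcc)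
    rwa [Set.uIcc_of_le zero_le_one] at this
  have hmaps : ∀ x : ℝ, vFun x ^ 2 ∈ Set.Icc (0 : ℝ) 1 := fun x =>
    ⟨sq_nonneg _, by linarith [(ofReal_vFun x).2.2.2.2.1]⟩
  have hder : ∀ x ∈ Set.Ioo (0 : ℝ) (1 / 2),
      HasDerivAt (fun x => G (vFun x ^ 2)) ((2 * k : ℝ) : ℂ) x := by
    intro x hx
    have h1 := (ofReal_vFun x).2.2.1 (th11_ofReal_ne_zero hx)
    have h2 := (ofReal_vFun x).2.2.2.2.2 (th10_ofReal_ne_zero hx)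
    have hg := hasDerivAt_integral_betaIntegrand hu hv (x := vFun x ^ 2)
      ⟨by positivity, by linarith⟩
    have hs := (hasDerivAt_vFun hx).pow 2
    refine (hg.scomp x hs).congr_deriv ?_
    have hb : betaIntegrand (1 / 4) (1 / 2) (vFun x ^ 2)
        = ((vFun x ^ (-(3 / 2) : ℝ) * (1 - vFun x ^ 2) ^ (-(1 / 2) : ℝ) : ℝ) : ℂ) := by
      rw [betaIntegrand, Complex.ofReal_mul, Complex.ofReal_cpow h2.le,
        show (-(3 / 2) : ℝ) = (2 : ℕ) * (-(3 / 4)) by norm_num, Real.rpow_mul h1.le,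
        Real.rpow_natCast, Complex.ofReal_cpow (by positivity)]
      push_cast
      norm_num
    rw [hb, Complex.real_smul, ← Complex.ofReal_mul]
    congr 1
    have e1 : vFun x ^ (-(3 / 2) : ℝ) * vFun x ^ (1 / 2 : ℝ) * vFun x = 1 := by
      rw [← Real.rpow_add h1, ← Real.rpow_add_one h1.ne']
      norm_num
    have e2 : (1 - vFun x ^ 2) ^ (-(1 / 2) : ℝ) * (1 - vFun x ^ 2) ^ (1 / 2 : ℝ) = 1 := by
      rw [← Real.rpow_add h2]
      norm_num
    rw [← hk]
    push_cast
    calc _ = 2 * k * (vFun x ^ (-(3 / 2) : ℝ) * vFun x ^ (1 / 2 : ℝ) * vFun x)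
          * ((1 - vFun x ^ 2) ^ (-(1 / 2) : ℝ) * (1 - vFun x ^ 2) ^ (1 / 2 : ℝ)) := by
          norm_num
          ring
      _ = 2 * k := by rw [e1, e2]; ring
  have h := intervalIntegral.integral_eq_sub_of_hasDerivAt_of_le (by norm_num : (0 : ℝ) ≤ 1 / 2)
    (f := fun x => G (vFun x ^ 2)) (hGc.comp (continuous_vFun.pow 2).continuousOn
      (fun x _ => hmaps x)) hder intervalIntegrable_const
  rw [intervalIntegral.integral_const, vFun_zero, vFun_half] at h
  have hB : G (1 ^ 2) - G (0 ^ 2) = Complex.betaIntegral (1 / 4) (1 / 2) := by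
    simp only [hG, one_pow, ne_eq, OfNat.ofNat_ne_zero, not_false_eq_true, zero_pow,
      intervalIntegral.integral_same, sub_zero]
    rfl
  rw [← hB, ← h, Complex.real_smul, ← Complex.ofReal_mul, hk]
  push_cast
  ring

/-- In terms of Γ, this is the reflection formula Γ(1/4) Γ(3/4) = √2 π combined with Γ(1/2)² = π. -/
lemma betaIntegral_quarter_quarter :
    Complex.betaIntegral (1 / 4) (1 / 4) = √2 * Complex.betaIntegral (1 / 4) (1 / 2) := by
  have h1 := Complex.Gamma_mul_Gamma_eq_betaIntegral (s := 1 / 4) (t := 1 / 4)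
    (by norm_num) (by norm_num)
  have h2 := Complex.Gamma_mul_Gamma_eq_betaIntegral (s := 1 / 4) (t := 1 / 2)
    (by norm_num) (by norm_num)
  have h3 := Complex.Gamma_mul_Gamma_one_sub (1 / 4)
  have h4 := Complex.Gamma_one_half_eq
  have h5 : Complex.sin (Real.pi * (1 / 4)) = (√2 / 2 : ℝ) := by
    rw [← Real.sin_pi_div_four]
    push_cast
    ring_nf
  rw [h5] at h3
  norm_num at h1 h2 h3
  have h6 : Complex.Gamma (1 / 2) ^ 2 = Real.pi := by
    rw [h4, ← Complex.cpow_nat_mul]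
    norm_num
  have g2 : Complex.Gamma (1 / 2) ≠ 0 := Complex.Gamma_ne_zero_of_re_pos (by norm_num)
  have g3 : Complex.Gamma (3 / 4) ≠ 0 := Complex.Gamma_ne_zero_of_re_pos (by norm_num)
  have s2 : (√2 : ℂ) ≠ 0 := by exact_mod_cast (Real.sqrt_pos.2 two_pos).ne'
  have s22 : (√2 : ℂ) ^ 2 = 2 := by exact_mod_cast Real.sq_sqrt two_pos.le
  have hgl : Complex.Gamma (1 / 4) * Complex.Gamma (3 / 4) = √2 * Real.pi := by
    rw [h3]
    field_simp
    rw [s22]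
  apply mul_left_cancel₀ (mul_ne_zero g2 g3)
  linear_combination -Complex.Gamma (3 / 4) * h1 + √2 * Complex.Gamma (1 / 2) * h2
    + Complex.Gamma (1 / 4) * hgl - √2 * Complex.Gamma (1 / 4) * h6

theorem period_eq : period = (1 - I) * Complex.betaIntegral (1 / 4) (1 / 4) := by
  rw [betaIntegral_quarter_quarter, betaIntegral_quarter_half, period, ofReal_th00_zero_re]
  have s22 : (√2 : ℂ) ^ 2 = 2 := by exact_mod_cast Real.sq_sqrt two_pos.le
  linear_combination (-(1 - I) * Real.pi * th00 0 ^ 2) * s22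

/-! ### The uniformization of the curve -/

lemma half_char_exp : cexp (2 * Real.pi * I * ((1 / 2 : ℚ) : ℂ)) = -1 := by
  rw [← Complex.exp_pi_mul_I]
  push_cast
  ring_nf

lemma th00_add_one (z : ℂ) : th00 (z + 1) = th00 z := by
  simp [th00, theta_add_one]

lemma th01_add_one (z : ℂ) : th01 (z + 1) = th01 z := by
  simp [th01, theta_add_one]

lemma th10_add_one (z : ℂ) : th10 (z + 1) = -th10 z := by
  rw [th10, theta_add_one, half_char_exp, neg_one_mul, th10]

lemma th11_add_one (z : ℂ) : th11 (z + 1) = -th11 z := by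
  rw [th11, theta_add_one, half_char_exp, neg_one_mul, th11]

/-- The factor of automorphy of `ϑ₀₀(z, i)` for the period `i`. -/
def autFactor (z : ℂ) : ℂ := cexp (-(Real.pi * I * I) - 2 * Real.pi * I * z)

lemma autFactor_ne_zero (z : ℂ) : autFactor z ≠ 0 := Complex.exp_ne_zero _

lemma autFactor_half (z : ℂ) :
    cexp (-(Real.pi * I * I) - 2 * Real.pi * I * (z + ((1 / 2 : ℚ) : ℂ))) = -autFactor z := by
  rw [mul_add, ← sub_sub, Complex.exp_sub _ (2 * Real.pi * I * ((1 / 2 : ℚ) : ℂ)), half_char_exp,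
    autFactor, div_neg, div_one]

lemma th00_add_I (z : ℂ) : th00 (z + I) = autFactor z * th00 z := by
  simp [th00, theta_add_tau, autFactor]

lemma th01_add_I (z : ℂ) : th01 (z + I) = -autFactor z * th01 z := by
  rw [th01, theta_add_tau, autFactor_half, th01]

lemma th10_add_I (z : ℂ) : th10 (z + I) = autFactor z * th10 z := by
  simp [th10, theta_add_tau, autFactor]

lemma th11_add_I (z : ℂ) : th11 (z + I) = -autFactor z * th11 z := by
  rw [th11, theta_add_tau, autFactor_half, th11]

lemma tFun_add_one (z : ℂ) : tFun (z + 1) = tFun z := by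
  simp only [tFun, th00_add_one, th01_add_one, th10_add_one, neg_sq]

lemma uFun_add_one (z : ℂ) : uFun (z + 1) = uFun z := by
  simp only [uFun, th00_add_one, th01_add_one, th10_add_one, th11_add_one, mul_neg, neg_mul,
    neg_neg]

lemma wFun_add_one (z : ℂ) : wFun (z + 1) = wFun z := by
  simp only [wFun, th00_add_one, th11_add_one, neg_sq]

lemma tFun_add_I (z : ℂ) : tFun (z + I) = tFun z := by
  have h := autFactor_ne_zero z
  simp only [tFun, th00_add_I, th01_add_I, th10_add_I]
  rw [← mul_div_mul_left (2 * (th01 z ^ 2 * th10 z ^ 2)) (th00 z ^ 4) (pow_ne_zero 4 h)]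
  ring_nf

lemma uFun_add_I (z : ℂ) : uFun (z + I) = uFun z := by
  have h := autFactor_ne_zero z
  simp only [uFun, th00_add_I, th01_add_I, th10_add_I, th11_add_I]
  rw [← mul_div_mul_left (-(1 - I) * (th01 z * th10 z * th11 z)) (th00 z ^ 3) (pow_ne_zero 3 h)]
  ring_nf

lemma wFun_add_I (z : ℂ) : wFun (z + I) = wFun z := by
  have h := autFactor_ne_zero z
  simp only [wFun, th00_add_I, th11_add_I]
  rw [← mul_div_mul_left (-I * th11 z ^ 2) (th00 z ^ 2) (pow_ne_zero 2 h)]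
  ring_nf

/-- The uniformization of the affine curve. -/
def affineParam (z : ℂ) (hz : th00 z ≠ 0) : AffineModel :=
  ⟨(tFun z, uFun z, wFun z), wFun_sq hz, uFun_sq hz⟩

open Classical in
/-- The uniformization of the compact curve by the complex plane. -/
def param (z : ℂ) : Model :=
  if hz : th00 z = 0 then OnePoint.infty else (affineParam z hz : Model)

lemma param_of_ne {z : ℂ} (hz : th00 z ≠ 0) : param z = (affineParam z hz : Model) := dif_neg hz

lemma param_of_eq {z : ℂ} (hz : th00 z = 0) : param z = OnePoint.infty := dif_pos hz

lemma param_congr {x y : ℂ} (h : th00 x = 0 ↔ th00 y = 0) (ht : tFun x = tFun y)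
    (hu : uFun x = uFun y) (hw : wFun x = wFun y) : param x = param y := by
  by_cases hx : th00 x = 0
  · rw [param_of_eq hx, param_of_eq (h.1 hx)]
  · rw [param_of_ne hx, param_of_ne (mt h.2 hx), OnePoint.coe_eq_coe]
    simp [affineParam, ht, hu, hw]

lemma param_add_lattice (z : ℂ) {l : ℂ} (hl : l ∈ lattice) : param (z + l) = param z :=
  periodic_lattice
    (fun z => param_congr (by rw [th00_add_one]) (tFun_add_one z) (uFun_add_one z)
      (wFun_add_one z))
    (fun z => param_congr (by simp [th00_add_I, autFactor_ne_zero]) (tFun_add_I z) (uFun_add_I z)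
      (wFun_add_I z)) hl z

/-- The uniformization of the compact curve by the torus. -/
def torusParam : Torus → Model :=
  Quotient.lift param fun a b h => by
    have := param_add_lattice a (QuotientAddGroup.leftRel_apply.1 h)
    rw [← this]
    congr 1
    ring

lemma torusParam_coe (z : ℂ) : torusParam (z : Torus) = param z := rfl

lemma continuousAt_tFun {z : ℂ} (hz : th00 z ≠ 0) : ContinuousAt tFun z :=
  (hasDerivAt_tFun hz).continuousAt

lemma continuousAt_wFun {z : ℂ} (hz : th00 z ≠ 0) : ContinuousAt wFun z :=
  (hasDerivAt_wFun hz).continuousAt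

lemma continuousAt_uFun {z : ℂ} (hz : th00 z ≠ 0) : ContinuousAt uFun z := by
  have h00 := differentiable_th00.continuous
  have h01 := differentiable_th01.continuous
  have h10 := differentiable_th10.continuous
  have h11 := differentiable_th11.continuous
  exact ContinuousAt.div (by fun_prop) (by fun_prop) (pow_ne_zero 3 hz)

lemma continuous_param : Continuous param := by
  rw [continuous_iff_continuousAt]
  intro z
  by_cases hz : th00 z = 0
  · rw [ContinuousAt, param_of_eq hz, OnePoint.hasBasis_nhds_infty.tendsto_right_iff]
    rintro K ⟨-, hK⟩
    -- The coordinate w is bounded on K but blows up at a zero of θ₀₀, because θ₁₁ does not vanish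
    -- there; so `param` leaves K nearby.
    obtain ⟨M, hM⟩ := (hK.image (f := fun p : AffineModel => p.1.2.2)
      (by fun_prop)).isBounded.exists_norm_le
    have h11 : th11 z ≠ 0 := by
      intro h
      rw [th00, theta_eq_zero_iff] at hz
      rw [th11_eq_zero_iff] at h
      have := sub_mem hz h
      push_cast at this
      have h2 := half_notMem_lattice (x := -(1 / 2)) (y := -(1 / 2)) (Or.inl half_ne_int)
      push_cast at h2
      ring_nf at this h2
      exact h2 this
    have h00c := differentiable_th00.continuous
    have h11c := differentiable_th11.continuous
    have hev : ∀ᶠ y in 𝓝 z, M * ‖th00 y‖ ^ 2 < ‖th11 y‖ ^ 2 := by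
      refine ContinuousAt.eventually_lt (by fun_prop) (by fun_prop) ?_
      have : 0 < ‖th11 z‖ ^ 2 := pow_pos (norm_pos_iff.2 h11) 2
      simpa [hz] using this
    filter_upwards [hev] with y hy
    by_cases h0 : th00 y = 0
    · exact Or.inr (param_of_eq h0)
    · refine Or.inl ⟨affineParam y h0, fun hmem => ?_, (param_of_ne h0).symm⟩
      have h1 := hM _ ⟨_, hmem, rfl⟩
      have h2 : ‖wFun y‖ ≤ M := h1
      rw [wFun, norm_div, norm_mul, norm_neg, Complex.norm_I, one_mul, norm_pow, norm_pow,
        div_le_iff₀ (by have := norm_pos_iff.2 h0; positivity)] at h2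
      exact absurd hy (not_lt.2 h2)
  · have hc : Continuous fun y : {z : ℂ // th00 z ≠ 0} => (affineParam y.1 y.2 : Model) := by
      refine OnePoint.continuous_coe.comp (Continuous.subtype_mk ?_ _)
      rw [continuous_iff_continuousAt]
      rintro ⟨y, hy⟩
      have hv : ContinuousAt (Subtype.val : {z : ℂ // th00 z ≠ 0} → ℂ) ⟨y, hy⟩ :=
        continuousAt_subtype_val
      exact ((continuousAt_tFun hy).comp_of_eq hv rfl).prodMk
        (((continuousAt_uFun hy).comp_of_eq hv rfl).prodMk
          ((continuousAt_wFun hy).comp_of_eq hv rfl))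
    have he : (param ∘ Subtype.val : {z : ℂ // th00 z ≠ 0} → Model)
        = fun y => (affineParam y.1 y.2 : Model) := funext fun y => param_of_ne y.2
    rw [← he] at hc
    exact (isOpen_th00_ne.isOpenEmbedding_subtypeVal.continuousAt_iff (x := ⟨z, hz⟩)).1
      hc.continuousAt

lemma continuous_torusParam : Continuous torusParam := continuous_param.quotient_lift _

lemma torus_coe_eq {x y : ℂ} : (x : Torus) = (y : Torus) ↔ y - x ∈ lattice := by
  rw [QuotientAddGroup.eq, neg_add_eq_sub]

/-! ### Injectivity of the uniformization -/

lemma uFun_neg (z : ℂ) : uFun (-z) = -uFun z := by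
  simp only [uFun, th00_neg, th01_neg, th10_neg, th11_neg]
  ring

lemma wFun_neg (z : ℂ) : wFun (-z) = wFun z := by
  simp only [wFun, th00_neg, th11_neg, neg_sq]

lemma th_consts_ne_zero : th00 0 * th01 0 * th10 0 ≠ 0 :=
  mul_ne_zero (mul_ne_zero th00_zero_ne th01_zero_ne) th10_zero_ne

lemma th11_mul_of_wFun_eq {x y : ℂ} (hx : th00 x ≠ 0) (hy : th00 y ≠ 0)
    (h : wFun x = wFun y) : th11 (x + y) * th11 (x - y) = 0 := by
  rw [wFun, wFun, div_eq_div_iff (pow_ne_zero 2 hx) (pow_ne_zero 2 hy)] at h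
  have h2 : th00 0 ^ 2 * (th11 (x + y) * th11 (x - y)) = 0 := by
    have h3 : th11 x ^ 2 * th00 y ^ 2 - th11 y ^ 2 * th00 x ^ 2 = 0 := by
      apply mul_left_cancel₀ (neg_ne_zero.2 I_ne_zero)
      linear_combination h
    rw [th00_sq, th00_sq, th11_sq, th11_sq] at h3
    rw [th11_add_mul_sub, th00_sq]
    linear_combination h3
  exact (mul_eq_zero.1 h2).resolve_left (pow_ne_zero 2 th00_zero_ne)

lemma two_mul_mem_lattice_of_uFun_eq_zero {z : ℂ} (hz : th00 z ≠ 0) (h : uFun z = 0) :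
    2 * z ∈ lattice := by
  rw [← th11_eq_zero_iff]
  rw [uFun, div_eq_zero_iff, or_iff_left (pow_ne_zero 3 hz), mul_eq_zero,
    or_iff_right (neg_ne_zero.2 one_sub_I_ne)] at h
  have h2 := th11_two_mul z
  rw [show 2 * (th00 z * th01 z * th10 z * th11 z)
    = 2 * th00 z * (th01 z * th10 z * th11 z) by ring, h, mul_zero] at h2
  exact (mul_eq_zero.1 h2).resolve_left th_consts_ne_zero

/-- Equal w forces y ≡ ±x modulo the lattice. In the case y ≡ -x, oddness of u gives u(y) = 0, so y
is a half period and y ≡ -y ≡ x. -/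
lemma injective_torusParam : Function.Injective torusParam := by
  intro p q
  induction p using QuotientAddGroup.induction_on with | H x => ?_
  induction q using QuotientAddGroup.induction_on with | H y => ?_
  intro h
  rw [torusParam_coe, torusParam_coe] at h
  rw [torus_coe_eq]
  by_cases hx : th00 x = 0
  · by_cases hy : th00 y = 0
    · rw [th00, theta_eq_zero_iff] at hx hy
      have := sub_mem hy hx
      ring_nf at this ⊢
      exact this
    · rw [param_of_eq hx, param_of_ne hy] at h
      exact absurd h (OnePoint.infty_ne_coe _)
  · by_cases hy : th00 y = 0
    · rw [param_of_ne hx, param_of_eq hy] at h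
      exact absurd h (OnePoint.coe_ne_infty _)
    · rw [param_of_ne hx, param_of_ne hy, OnePoint.coe_eq_coe] at h
      have h' := congrArg Subtype.val h
      simp only [affineParam, Prod.mk.injEq] at h'
      obtain ⟨-, hu, hw⟩ := h'
      rcases mul_eq_zero.1 (th11_mul_of_wFun_eq hx hy hw) with h1 | h1
      · rw [th11_eq_zero_iff] at h1
        have h2 : uFun x = -uFun y := by
          rw [← uFun_neg, ← periodic_lattice uFun_add_one uFun_add_I h1 (-y)]
          ring_nf
        have h3 : uFun y = 0 := by
          rw [hu] at h2
          exact self_eq_neg.1 h2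
        have := sub_mem (two_mul_mem_lattice_of_uFun_eq_zero hy h3) h1
        ring_nf at this ⊢
        exact this
      · rw [th11_eq_zero_iff] at h1
        simpa using neg_mem h1

/-! ### Compactness of the torus and surjectivity -/

/-- The closed unit square around `0`. -/
def unitSquare : Set ℂ := Set.Icc (-(1 / 2)) (1 / 2) ×ℂ Set.Icc (-(1 / 2)) (1 / 2)

lemma isCompact_unitSquare : IsCompact unitSquare := isCompact_Icc.reProdIm isCompact_Icc

lemma exists_mem_unitSquare (z : ℂ) : ∃ l ∈ lattice, z - l ∈ unitSquare := by
  obtain ⟨l, hl, h1, h2⟩ := exists_lattice_sub z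
  exact ⟨l, hl, abs_le.1 h1, abs_le.1 h2⟩

instance : CompactSpace Torus := by
  refine ⟨?_⟩
  have h : (QuotientAddGroup.mk : ℂ → Torus) '' unitSquare = Set.univ := by
    refine Set.eq_univ_of_forall fun p => ?_
    induction p using QuotientAddGroup.induction_on with | H z => ?_
    obtain ⟨l, hl, hz⟩ := exists_mem_unitSquare z
    exact ⟨z - l, hz, torus_coe_eq.2 (by simpa using hl)⟩
  rw [← h]
  exact isCompact_unitSquare.image continuous_quotient_mk'

/-- An entire function with the periods `1` and `i` is constant. -/
lemma eq_of_entire_periodic {f : ℂ → ℂ} (hf : Differentiable ℂ f) (h1 : ∀ z, f (z + 1) = f z)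
    (hI : ∀ z, f (z + I) = f z) (x y : ℂ) : f x = f y := by
  refine hf.apply_eq_apply_of_bounded ?_ x y
  refine (isCompact_unitSquare.image hf.continuous).isBounded.subset ?_
  rintro _ ⟨z, rfl⟩
  obtain ⟨l, hl, hz⟩ := exists_mem_unitSquare z
  refine ⟨z - l, hz, ?_⟩
  rw [sub_eq_add_neg, periodic_lattice h1 hI (neg_mem hl)]

lemma not_mem_lattice_quarter : (1 / 4 : ℂ) ∉ lattice := by
  have := half_notMem_lattice (x := 1 / 4) (y := 0)
    (Or.inl (ne_int_of_mem_Ioo (k := 0) (by norm_num) (by norm_num)))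
  push_cast at this
  simpa using this

/-- If w were omitted, θ₁₁² / (θ₁₁² - i w θ₀₀²) would be entire and doubly periodic, hence constant
by Liouville. But it vanishes at 0 and not at 1/4. -/
lemma exists_wFun_eq (w : ℂ) : ∃ z, th00 z ≠ 0 ∧ wFun z = w := by
  by_cases hex : ∃ z, th11 z ^ 2 - I * w * th00 z ^ 2 = 0
  · obtain ⟨z, hz⟩ := hex
    have h00 : th00 z ≠ 0 := by
      intro h
      rw [h] at hz
      have h11 : th11 z = 0 := by simpa using hz
      rw [th00, theta_eq_zero_iff] at h
      rw [th11_eq_zero_iff] at h11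
      have := sub_mem h h11
      have h2 := half_notMem_lattice (x := -(1 / 2)) (y := -(1 / 2)) (Or.inl half_ne_int)
      push_cast at this h2
      ring_nf at this h2
      exact h2 this
    refine ⟨z, h00, ?_⟩
    rw [wFun, div_eq_iff (pow_ne_zero 2 h00)]
    linear_combination -I * hz + (-w * th00 z ^ 2) * Complex.I_sq
  · exfalso
    push Not at hex
    have h00 := differentiable_th00
    have h11 := differentiable_th11
    have hd : Differentiable ℂ fun z => th11 z ^ 2 / (th11 z ^ 2 - I * w * th00 z ^ 2) :=
      Differentiable.div (by fun_prop) (by fun_prop) hex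
    have := eq_of_entire_periodic hd (fun z => by simp only [th00_add_one, th11_add_one, neg_sq])
      (fun z => by
        have h := autFactor_ne_zero z
        simp only [th00_add_I, th11_add_I]
        rw [← mul_div_mul_left (th11 z ^ 2) (th11 z ^ 2 - I * w * th00 z ^ 2) (pow_ne_zero 2 h)]
        ring_nf) (1 / 4) 0
    simp only [th11_zero] at this
    rw [zero_pow two_ne_zero, zero_div, div_eq_zero_iff, or_iff_left (hex _)] at this
    exact not_mem_lattice_quarter ((th11_eq_zero_iff _).1 (pow_eq_zero_iff two_ne_zero |>.1 this))

lemma surjective_torusParam : Function.Surjective torusParam := by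
  intro P
  induction P using OnePoint.rec with
  | infty =>
    refine ⟨((1 / 2 + 1 / 2 * I : ℂ) : Torus), ?_⟩
    rw [torusParam_coe, param_of_eq]
    rw [th00, theta_eq_zero_iff]
    convert zero_mem lattice using 1
    push_cast
    ring
  | coe p =>
    obtain ⟨⟨t, u, w⟩, h1, h2⟩ := p
    simp only at h1 h2
    obtain ⟨z, hz, hw⟩ := exists_wFun_eq w
    have ht : tFun z = t := by
      have := wFun_sq hz
      rw [hw, h1] at this
      linear_combination -this
    have hu : u ^ 2 = uFun z ^ 2 := by rw [uFun_sq hz, hw, ht, h2]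
    rcases sq_eq_sq_iff_eq_or_eq_neg.1 hu with h | h
    · refine ⟨(z : Torus), ?_⟩
      rw [torusParam_coe, param_of_ne hz, OnePoint.coe_eq_coe]
      simp [affineParam, ht, hw, h]
    -- The other square root of u² is reached by z ↦ -z, under which w and t are even and u is odd.
    · have hz' : th00 (-z) ≠ 0 := by rwa [th00_neg]
      have ht' : tFun (-z) = t := by
        have := wFun_sq hz'
        rw [wFun_neg, hw, h1] at this
        linear_combination -this
      refine ⟨((-z : ℂ) : Torus), ?_⟩
      rw [torusParam_coe, param_of_ne hz', OnePoint.coe_eq_coe]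
      simp [affineParam, ht', wFun_neg, uFun_neg, hw, h]

instance : LocallyCompactSpace AffineModel := by
  have : IsClosed {p : ℂ × ℂ × ℂ | p.2.2 ^ 2 = p.1 - 1 ∧ p.2.1 ^ 2 = p.1 * p.2.2} :=
    (isClosed_eq (by fun_prop) (by fun_prop)).inter (isClosed_eq (by fun_prop) (by fun_prop))
  exact this.isClosedEmbedding_subtypeVal.locallyCompactSpace

/-- The uniformization of the curve by the torus, as a homeomorphism. -/
def torusHomeo : Torus ≃ₜ Model :=
  Continuous.homeoOfEquivCompactToT2
    (f := Equiv.ofBijective torusParam ⟨injective_torusParam, surjective_torusParam⟩)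
    continuous_torusParam

lemma torusHomeo_coe (z : ℂ) : torusHomeo (z : Torus) = param z := rfl

lemma torusHomeo_zero : torusHomeo ((0 : ℂ) : Torus) = basePoint := by
  rw [torusHomeo_coe, param_of_ne th00_zero_ne, basePoint, OnePoint.coe_eq_coe]
  simp [affineParam, tFun_eq th00_zero_ne, uFun, wFun, th11_zero]

/-! ### The form `φ` in the uniformization -/

lemma isUnramified_param_iff (z : ℂ) :
    IsUnramified (param z) ↔ th00 z ≠ 0 ∧ tFun z ≠ 0 ∧ tFun z ≠ 1 := by
  constructor
  · rintro ⟨p, hp, h0, h1⟩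
    by_cases hz : th00 z = 0
    · rw [param_of_eq hz] at hp
      exact absurd hp (OnePoint.infty_ne_coe p)
    · rw [param_of_ne hz, OnePoint.coe_eq_coe] at hp
      subst hp
      exact ⟨hz, h0, h1⟩
  · rintro ⟨hz, h0, h1⟩
    exact ⟨affineParam z hz, param_of_ne hz, h0, h1⟩

lemma tCoord_param {z : ℂ} (hz : th00 z ≠ 0) : tCoord (param z) = tFun z := by
  rw [param_of_ne hz]
  rfl

lemma uCoord_param {z : ℂ} (hz : th00 z ≠ 0) : uCoord (param z) = uFun z := by
  rw [param_of_ne hz]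
  rfl

lemma wFun_mul_uFun_ne_zero {z : ℂ} (hz : IsUnramified (param z)) : wFun z * uFun z ≠ 0 := by
  obtain ⟨h00, h0, h1⟩ := (isUnramified_param_iff z).1 hz
  have hw : wFun z ≠ 0 := by
    intro h
    have := wFun_sq h00
    rw [h] at this
    apply h1
    linear_combination -this
  refine mul_ne_zero hw fun h => ?_
  have := uFun_sq h00
  rw [h, zero_pow two_ne_zero] at this
  exact mul_ne_zero h0 hw this.symm

/-- On the curve t - 1 = w² and u² = t w, so u / (t (t - 1)) = 1 / (w u), which is `period` divided
by t'. -/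
lemma phi_param {z : ℂ} (hz : IsUnramified (param z)) (v : ℂ) :
    phi (param z) v = period * (v * (period * wFun z * uFun z)⁻¹) := by
  obtain ⟨h00, h0, h1⟩ := (isUnramified_param_iff z).1 hz
  have hwu := wFun_mul_uFun_ne_zero hz
  have hw := left_ne_zero_of_mul hwu
  have hu := right_ne_zero_of_mul hwu
  have hp := period_ne_zero
  rw [phi, tCoord_param h00, uCoord_param h00, ← wFun_sq h00]
  field_simp
  rw [uFun_sq h00]
  ring

lemma tCoord_param_eventuallyEq {z : ℂ} (hz : th00 z ≠ 0) :
    (fun y => tCoord (param y)) =ᶠ[𝓝 z] tFun := by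
  filter_upwards [isOpen_th00_ne.mem_nhds hz] with y hy using tCoord_param hy

lemma hasDerivAt_tCoord_param {z : ℂ} (hz : th00 z ≠ 0) :
    HasDerivAt (fun y => tCoord (param y)) (period * wFun z * uFun z) z :=
  (hasDerivAt_tFun hz).congr_of_eventuallyEq (tCoord_param_eventuallyEq hz)

lemma hasStrictDerivAt_tFun {z : ℂ} (hz : th00 z ≠ 0) :
    HasStrictDerivAt tFun (period * wFun z * uFun z) z := by
  have h : DifferentiableOn ℂ tFun {z | th00 z ≠ 0} := fun y hy =>
    (hasDerivAt_tFun hy).differentiableAt.differentiableWithinAt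
  have := (h.analyticAt (isOpen_th00_ne.mem_nhds hz)).hasStrictDerivAt
  rwa [(hasDerivAt_tFun hz).deriv] at this

/-! ### Lifting of paths -/

lemma eq_zero_of_mem_lattice {z : ℂ} (hz : z ∈ lattice) (h : ‖z‖ < 1) : z = 0 := by
  obtain ⟨m, n, rfl⟩ := mem_lattice.1 hz
  have h1 : |(m : ℝ)| < 1 := by simpa using (Complex.abs_re_le_norm _).trans_lt h
  have h2 : |(n : ℝ)| < 1 := by simpa using (Complex.abs_im_le_norm _).trans_lt h
  have h3 : m = 0 := Int.abs_lt_one_iff.1 (by exact_mod_cast h1)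
  have h4 : n = 0 := Int.abs_lt_one_iff.1 (by exact_mod_cast h2)
  simp [h3, h4]

lemma isDiscrete_lattice : IsDiscrete (lattice : Set ℂ) := by
  refine ⟨?_⟩
  change DiscreteTopology lattice
  refine discreteTopology_of_isOpen_singleton_zero ?_
  have : ({0} : Set lattice) = Subtype.val ⁻¹' Metric.ball (0 : ℂ) 1 := by
    ext ⟨z, hz⟩
    simp only [Set.mem_singleton_iff, Set.mem_preimage, mem_ball_zero_iff]
    constructor
    · intro h
      rw [show z = 0 from congrArg Subtype.val h]
      simp
    · intro h
      exact Subtype.ext (eq_zero_of_mem_lattice hz h)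
  rw [this]
  exact Metric.isOpen_ball.preimage continuous_subtype_val

lemma isCoveringMap_torus : IsCoveringMap (QuotientAddGroup.mk : ℂ → Torus) :=
  (lattice.isAddQuotientCoveringMap_of_comm isDiscrete_lattice).isCoveringMap

/-- A path on the curve which starts at the base point lifts to the complex plane. -/
lemma exists_lift {P : Model} (γ : Path basePoint P) :
    ∃ g : ℝ → ℂ, Continuous g ∧ g 0 = 0 ∧ ∀ s, param (g s) = γ.extend s := by
  obtain ⟨Γ, hΓ, h0⟩ := isCoveringMap_torus.exists_path_lifts
    ⟨fun s => torusHomeo.symm (γ s), torusHomeo.symm.continuous.comp γ.continuous⟩ 0 (by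
      change torusHomeo.symm (γ 0) = ((0 : ℂ) : Torus)
      rw [γ.source, ← torusHomeo_zero, Homeomorph.symm_apply_apply])
  refine ⟨fun s => Γ (Set.projIcc 0 1 zero_le_one s), Γ.continuous.comp continuous_projIcc, ?_,
    fun s => ?_⟩
  · simp only [Set.projIcc_left]
    exact h0
  · have := congrFun hΓ (Set.projIcc 0 1 zero_le_one s)
    simp only [Function.comp_apply, ContinuousMap.coe_mk] at this
    rw [← torusHomeo_coe, this, Homeomorph.apply_symm_apply]
    rfl

/-- The lift is only known to be continuous. At an unramified point t is locally biholomorphic in z,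
so locally the lift is the inverse of t applied to the t-coordinate of the path, and this gives its
derivative. -/
lemma hasDerivAt_lift {P Q : Model} {γ : Path P Q} {g : ℝ → ℂ} (hg : Continuous g)
    (hγ : ∀ s, param (g s) = γ.extend s) {s : ℝ} (hs : IsUnramified (γ.extend s))
    (hd : DifferentiableAt ℝ (fun r : ℝ => tCoord (γ.extend r)) s) :
    HasDerivAt (fun r => period * g r) (pathIntegrand γ s) s := by
  rw [pathIntegrand]
  rw [← hγ] at hs ⊢
  have h00 := ((isUnramified_param_iff _).1 hs).1
  rw [phi_param hs]
  refine HasDerivAt.const_mul period ?_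
  have hne : period * wFun (g s) * uFun (g s) ≠ 0 := by
    rw [mul_assoc]
    exact mul_ne_zero period_ne_zero (wFun_mul_uFun_ne_zero hs)
  have hst := hasStrictDerivAt_tFun h00
  have hgt : (fun r : ℝ => tCoord (γ.extend r)) =ᶠ[𝓝 s] fun r => tFun (g r) := by
    filter_upwards [hg.continuousAt.eventually (tCoord_param_eventuallyEq h00)] with r hr
    rw [← hγ r]
    exact hr
  have hinv : HasDerivAt (hst.localInverse tFun _ _ hne) (period * wFun (g s) * uFun (g s))⁻¹
      (tCoord (γ.extend s)) := by
    rw [hgt.eq_of_nhds]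
    exact (hst.to_localInverse hne).hasDerivAt
  refine (hinv.scomp s hd.hasDerivAt).congr_of_eventuallyEq ?_
  filter_upwards [hgt, hg.continuousAt.eventually (hst.eventually_left_inverse hne)] with r h1 h2
  rw [Function.comp_apply, h1, h2]

/-- The fundamental theorem of calculus allows finitely many exceptional times because `period * g`
is continuous everywhere, even where the path meets ramification points. -/
lemma pathIntegral_eq {P Q : Model} {γ : Path P Q} (hadm : IsAdmissible γ) {g : ℝ → ℂ}
    (hg : Continuous g) (hγ : ∀ s, param (g s) = γ.extend s) :
    pathIntegral γ = period * g 1 - period * g 0 := by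
  obtain ⟨⟨S, hS⟩, hint⟩ := hadm
  refine MeasureTheory.integral_eq_of_hasDerivAt_off_countable (fun r => period * g r) _
    S.countable_toSet (by fun_prop) ?_ hint
  rintro s ⟨hs, hsS⟩
  rw [min_eq_left zero_le_one, max_eq_right zero_le_one] at hs
  obtain ⟨h1, h2, -⟩ := hS s hs hsS
  exact hasDerivAt_lift hg hγ h1 h2

lemma normalizedIntegral_eq {P Q : Model} (γ : Path P Q) :
    normalizedIntegral γ = pathIntegral γ / period := by
  rw [normalizedIntegral, period_eq]

/-- The integral of the normalized form along any admissible path inverts the uniformization. -/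
theorem normalizedIntegral_coe {P : Model} {γ : Path basePoint P} (hadm : IsAdmissible γ) :
    ((normalizedIntegral γ : ℂ) : Torus) = torusHomeo.symm P := by
  obtain ⟨g, hg, h0, hγ⟩ := exists_lift γ
  rw [normalizedIntegral_eq, pathIntegral_eq hadm hg hγ, h0, mul_zero, sub_zero,
    mul_div_cancel_left₀ _ period_ne_zero, Homeomorph.eq_symm_apply, torusHomeo_coe, hγ,
    Path.extend_one]

/-! ### Existence of admissible paths -/

lemma exists_param_eq (P : Model) : ∃ z : ℂ, z ≠ 0 ∧ param z = P := by
  obtain ⟨p, hp⟩ := torusHomeo.surjective P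
  induction p using QuotientAddGroup.induction_on with | H z => ?_
  rw [torusHomeo_coe] at hp
  by_cases hz : z = 0
  -- The base point needs a nonzero representative: the constant segment would stay at a ramified
  -- point and not be admissible.
  · refine ⟨1, one_ne_zero, ?_⟩
    rw [← hp, hz, ← param_add_lattice 0 one_mem_lattice, zero_add]
  · exact ⟨z, hz, hp⟩

/-- The image on the curve of a segment which starts at `0`. -/
def segmentPath (z : ℂ) : Path basePoint (param z) where
  toFun s := param (s * z)
  continuous_toFun := continuous_param.comp (by fun_prop)
  source' := by rw [← torusHomeo_zero, torusHomeo_coe]; simp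
  target' := by simp

lemma segmentPath_extend (z : ℂ) {s : ℝ} (hs : s ∈ Set.Icc (0 : ℝ) 1) :
    (segmentPath z).extend s = param (s * z) := by
  rw [Path.extend_apply _ hs]
  rfl

lemma finite_lattice_inter (R : ℝ) : {z : ℂ | z ∈ lattice ∧ ‖z‖ ≤ R}.Finite := by
  refine (((Set.finite_Icc (-⌈R⌉) ⌈R⌉).prod (Set.finite_Icc (-⌈R⌉) ⌈R⌉)).image
    fun p : ℤ × ℤ => (p.1 + p.2 * I : ℂ)).subset ?_
  rintro z ⟨hz, hR⟩
  obtain ⟨m, n, rfl⟩ := mem_lattice.1 hz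
  have key : ∀ k : ℤ, |(k : ℝ)| ≤ R → k ∈ Set.Icc (-⌈R⌉) ⌈R⌉ := by
    intro k hk
    have h := abs_le.1 (hk.trans (Int.le_ceil R))
    exact ⟨by exact_mod_cast h.1, by exact_mod_cast h.2⟩
  exact ⟨(m, n), ⟨key m (by simpa using (Complex.abs_re_le_norm _).trans hR),
    key n (by simpa using (Complex.abs_im_le_norm _).trans hR)⟩, rfl⟩

lemma finite_segment_inter {z : ℂ} (hz : z ≠ 0) :
    {s : ℝ | s ∈ Set.Icc (0 : ℝ) 1 ∧ 2 * (s * z) ∈ lattice}.Finite := by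
  refine Set.Finite.of_finite_image (f := fun s : ℝ => 2 * (s * z))
    ((finite_lattice_inter (2 * ‖z‖)).subset ?_) ?_
  · rintro _ ⟨s, ⟨⟨h0, h1⟩, hs⟩, rfl⟩
    refine ⟨hs, ?_⟩
    rw [norm_mul, norm_mul, Complex.norm_two, Complex.norm_real, Real.norm_of_nonneg h0]
    nlinarith [norm_nonneg z]
  · intro a _ b _ h
    have h2 := mul_right_cancel₀ hz (mul_left_cancel₀ two_ne_zero h)
    exact_mod_cast h2

/-- By the duplication formula, none of the four theta functions vanishes away from the half
periods. -/
lemma isUnramified_param {z : ℂ} (hz : 2 * z ∉ lattice) : IsUnramified (param z) := by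
  rw [← th11_eq_zero_iff] at hz
  have h : 2 * (th00 z * th01 z * th10 z * th11 z) ≠ 0 := by
    rw [← th11_two_mul]
    exact mul_ne_zero th_consts_ne_zero hz
  simp only [ne_eq, mul_eq_zero, not_or] at h
  obtain ⟨-, ⟨⟨h00, h01⟩, h10⟩, h11⟩ := h
  refine (isUnramified_param_iff z).2 ⟨h00, ?_, ?_⟩
  · rw [tFun]
    exact div_ne_zero (mul_ne_zero two_ne_zero (mul_ne_zero (pow_ne_zero 2 h01)
      (pow_ne_zero 2 h10))) (pow_ne_zero 4 h00)
  · rw [tFun_eq h00, Ne, sub_eq_self]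
    exact div_ne_zero (pow_ne_zero 4 h11) (pow_ne_zero 4 h00)

lemma hasDerivAt_tCoord_segmentPath {z : ℂ} {s : ℝ} (hs : s ∈ Set.Ioo (0 : ℝ) 1)
    (h00 : th00 (s * z) ≠ 0) :
    HasDerivAt (fun r : ℝ => tCoord ((segmentPath z).extend r))
      (z * (period * wFun (s * z) * uFun (s * z))) s := by
  have h1 : HasDerivAt (fun r : ℝ => (r : ℂ) * z) z s := by
    simpa using (Complex.ofRealCLM.hasDerivAt (x := s)).mul_const z
  refine ((hasDerivAt_tCoord_param h00).scomp s h1).congr_of_eventuallyEq ?_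
  filter_upwards [Ioo_mem_nhds hs.1 hs.2] with r hr
  rw [segmentPath_extend z (Set.Ioo_subset_Icc_self hr)]
  rfl

lemma pathIntegrand_segmentPath {z : ℂ} {s : ℝ} (hs : s ∈ Set.Ioo (0 : ℝ) 1)
    (hun : IsUnramified (param (s * z))) :
    pathIntegrand (segmentPath z) s = period * z := by
  have h00 := ((isUnramified_param_iff _).1 hun).1
  rw [pathIntegrand, (hasDerivAt_tCoord_segmentPath hs h00).deriv,
    segmentPath_extend z (Set.Ioo_subset_Icc_self hs), phi_param hun, mul_inv_cancel_right₀]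
  rw [mul_assoc]
  exact mul_ne_zero period_ne_zero (wFun_mul_uFun_ne_zero hun)

theorem isAdmissible_segmentPath {z : ℂ} (hz : z ≠ 0) : IsAdmissible (segmentPath z) := by
  have hfin := finite_segment_inter hz
  have hun : ∀ s ∈ Set.Ioo (0 : ℝ) 1, s ∉ hfin.toFinset → IsUnramified (param (s * z)) := by
    intro s hs hsS
    refine isUnramified_param fun h => hsS ?_
    rw [Set.Finite.mem_toFinset]
    exact ⟨Set.Ioo_subset_Icc_self hs, h⟩
  refine ⟨⟨hfin.toFinset, fun s hs hsS => ?_⟩, ?_⟩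
  · have hu := hun s hs hsS
    have h00 := ((isUnramified_param_iff _).1 hu).1
    refine ⟨by rwa [segmentPath_extend z (Set.Ioo_subset_Icc_self hs)],
      (hasDerivAt_tCoord_segmentPath hs h00).differentiableAt, ?_⟩
    have hm : ContinuousAt (fun r : ℝ => (r : ℂ) * z) s := by fun_prop
    have hev : deriv (fun r : ℝ => tCoord ((segmentPath z).extend r))
        =ᶠ[𝓝 s] fun r : ℝ => z * (period * wFun (r * z) * uFun (r * z)) := by
      filter_upwards [Ioo_mem_nhds hs.1 hs.2, hm.eventually (isOpen_th00_ne.mem_nhds h00)]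
        with r hr hr0
      exact (hasDerivAt_tCoord_segmentPath hr hr0).deriv
    refine ContinuousAt.congr ?_ hev.symm
    exact continuousAt_const.mul ((continuousAt_const.mul
      ((continuousAt_wFun h00).comp_of_eq hm rfl)).mul ((continuousAt_uFun h00).comp_of_eq hm rfl))
  -- Away from finitely many times the integrand is the constant `period * z`.
  · refine (intervalIntegrable_const (c := period * z)).congr_ae ?_
    rw [Filter.EventuallyEq, MeasureTheory.ae_restrict_iff' measurableSet_uIoc]
    have hnull : MeasureTheory.volume ((hfin.toFinset : Set ℝ) ∪ {1}) = 0 :=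
      (hfin.toFinset.finite_toSet.union (Set.finite_singleton 1)).measure_zero _
    filter_upwards [MeasureTheory.compl_mem_ae_iff.2 hnull] with s hs hs01
    rw [Set.uIoc_of_le zero_le_one] at hs01
    simp only [Set.mem_compl_iff, Set.mem_union, Finset.mem_coe, Set.mem_singleton_iff,
      not_or] at hs
    have hs' : s ∈ Set.Ioo (0 : ℝ) 1 := ⟨hs01.1, lt_of_le_of_ne hs01.2 hs.2⟩
    exact (pathIntegrand_segmentPath hs' (hun s hs' hs.1)).symm

lemma exists_isAdmissible (P : Model) : ∃ γ : Path basePoint P, IsAdmissible γ := by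
  obtain ⟨z, hz, rfl⟩ := exists_param_eq P
  exact ⟨segmentPath z, isAdmissible_segmentPath hz⟩

theorem abelJacobi_eq (P : Model) : abelJacobi P = torusHomeo.symm P := by
  rw [abelJacobi, dif_pos (exists_isAdmissible P)]
  exact normalizedIntegral_coe (exists_isAdmissible P).choose_spec

end AbelJacobi

end

/-! ### Assembly of the main theorem -/

theorem mainTheorem1 :
    -- The Abel-Jacobi map is well defined: admissible paths exist, and all give the same value.
    (∀ P : AbelJacobi.Model,
      (∃ γ : Path AbelJacobi.basePoint P, AbelJacobi.IsAdmissible γ) ∧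
      ∀ γ : Path AbelJacobi.basePoint P, AbelJacobi.IsAdmissible γ →
        ((AbelJacobi.normalizedIntegral γ : ℂ) : AbelJacobi.Torus) = AbelJacobi.abelJacobi P) ∧
    -- It has an inverse `Ψ`, ...
    (∃ Ψ : AbelJacobi.Torus ≃ₜ AbelJacobi.Model,
      (∀ P : AbelJacobi.Model, Ψ.symm P = AbelJacobi.abelJacobi P) ∧
      -- ... which is given by theta functions, ...
      (∀ z : ℂ, Ψ (z : AbelJacobi.Torus) = OnePoint.infty ↔
        AbelJacobi.theta 0 0 z Complex.I = 0) ∧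
      (∀ z : ℂ, ∀ p : AbelJacobi.AffineModel,
        Ψ (z : AbelJacobi.Torus) = (p : AbelJacobi.Model) →
          p.1.1 = 2 * (AbelJacobi.theta 0 (1 / 2) z Complex.I ^ 2
              * AbelJacobi.theta (1 / 2) 0 z Complex.I ^ 2)
              / AbelJacobi.theta 0 0 z Complex.I ^ 4 ∧
          p.1.1 = 1 - AbelJacobi.theta (1 / 2) (1 / 2) z Complex.I ^ 4
              / AbelJacobi.theta 0 0 z Complex.I ^ 4 ∧
          p.1.2.1 = -(1 - Complex.I) *
              (AbelJacobi.theta 0 (1 / 2) z Complex.I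
                * AbelJacobi.theta (1 / 2) 0 z Complex.I
                * AbelJacobi.theta (1 / 2) (1 / 2) z Complex.I)
              / AbelJacobi.theta 0 0 z Complex.I ^ 3) ∧
      -- ... and which pulls the form `φ` back to `2 (1 - i) π ϑ₀₀(0,i)² dz`.
      (∀ z : ℂ, AbelJacobi.IsUnramified (Ψ (z : AbelJacobi.Torus)) →
        DifferentiableAt ℂ (fun y : ℂ => AbelJacobi.tCoord (Ψ (y : AbelJacobi.Torus))) z ∧
        AbelJacobi.phi (Ψ (z : AbelJacobi.Torus))
            (deriv (fun y : ℂ => AbelJacobi.tCoord (Ψ (y : AbelJacobi.Torus))) z) =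
          2 * (1 - Complex.I) * Real.pi * AbelJacobi.theta 0 0 0 Complex.I ^ 2)) ∧
    2 * (1 - Complex.I) * Real.pi * AbelJacobi.theta 0 0 0 Complex.I ^ 2 =
      (1 - Complex.I) * Complex.betaIntegral (1 / 4) (1 / 4) := by
  refine ⟨fun P => ⟨AbelJacobi.exists_isAdmissible P, fun γ hγ => ?_⟩,
    ⟨AbelJacobi.torusHomeo, fun P => (AbelJacobi.abelJacobi_eq P).symm, fun z => ?_,
      fun z p hp => ?_, fun z hz => ?_⟩, AbelJacobi.period_eq⟩
  · rw [AbelJacobi.normalizedIntegral_coe hγ, AbelJacobi.abelJacobi_eq]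
  · rw [AbelJacobi.torusHomeo_coe]
    by_cases h : AbelJacobi.th00 z = 0
    · exact iff_of_true (AbelJacobi.param_of_eq h) h
    · rw [AbelJacobi.param_of_ne h]
      exact iff_of_false (OnePoint.coe_ne_infty _) h
  · rw [AbelJacobi.torusHomeo_coe] at hp
    by_cases h : AbelJacobi.th00 z = 0
    · rw [AbelJacobi.param_of_eq h] at hp
      exact absurd hp (OnePoint.infty_ne_coe p)
    · rw [AbelJacobi.param_of_ne h, OnePoint.coe_eq_coe] at hp
      subst hp
      exact ⟨rfl, AbelJacobi.tFun_eq h, rfl⟩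
  · have h00 := ((AbelJacobi.isUnramified_param_iff z).1 hz).1
    have hd := AbelJacobi.hasDerivAt_tCoord_param h00
    refine ⟨hd.differentiableAt, ?_⟩
    change AbelJacobi.phi (AbelJacobi.param z)
      (deriv (fun y : ℂ => AbelJacobi.tCoord (AbelJacobi.param y)) z) = AbelJacobi.period
    rw [hd.deriv, AbelJacobi.phi_param hz, mul_inv_cancel₀, mul_one]
    rw [mul_assoc]
    exact mul_ne_zero AbelJacobi.period_ne_zero (AbelJacobi.wFun_mul_uFun_ne_zero hz)
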